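/- Let $p>3$ be a prime, $k$ a natural number, $N=p^{2k}$, $e(x)=e^{2\pi i x}$ and $r\equiv 2^{-1}$ (modulo powers of $p$). Let $U_N$ be the Weil representation of $SL(2,\mathbb Z_N)$ on $L^2(\mathbb Z_N)$ (with $\|\psi\|_2^2=\frac1N\sum_{x}|\psi(x)|^2$), given on generators by $$U_N\begin{pmatrix}1&b\\0&1\end{pmatrix}\psi(x)=e\Big(\frac{rbx^2}{N}\Big)\psi(x),\qquad U_N\begin{pmatrix}t&0\\0&t^{-1}\end{pmatrix}\psi(x)=\psi(tx),\qquad U_N\begin{pmatrix}0&1\\-1&0\end{pmatrix}\psi(x)=\frac1{\sqrt N}\sum_{y\in\mathbb Z_N}\psi(y)e\Big(\frac{2rxy}{N}\Big).$$ Let $D\in\mathbb Z_N$ and $C\in\mathbb Z_{p^k}$ with $p\nmid C$ and $p\nmid D$. Let $H_D$ be the group of matrices $\begin{pmatrix}a&bD\\b&a\end{pmatrix}$ over $\mathbb Z_N$ with $a^2-Db^2=1$; a normalized Hecke eigenfunction is a $\psi\in L^2(\mathbb Z_N)$ with $\|\psi\|_2=1$ that is an eigenvector of every $U_N(h)$,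 $h\in H_D$. For $x=(x_1,x_2)\in\mathbb Z_N^2$ let $\zeta_x=\sum_{t\in\mathbb Z_{p^k}}e(x_1t/p^k)\,\delta_{x_2+p^kt}$, and let $V_C$ be the span of the $\zeta_x$ with $x_1^2-Dx_2^2\equiv -C \pmod{p^k}$. **Theorem.** Let $\psi\in V_C$ be a normalized Hecke eigenfunction and let $b\in\mathbb Z_N$. Assume that, for some integers $x_0$ and $s$ with $p\nmid x_0$ and $0\le s<k/2$, the solutions of $x^2\equiv -C+Db^2\pmod{p^k}$ are exactly $x\equiv\pm x_0p^s+p^{k-s}m\pmod {p^k}$, $m\in\mathbb Z$. Then there is a unique $\Theta_\psi(b)\in\mathbb Z_{p^s}$ such that $$\Theta_\psi(b)\,p^k\equiv -x_0^2p^{2s}-\widetilde C+Db^2-p^{2(k-s)}3^{-1}rD^2b^2\pmod{p^{k+s}},$$ where $\widetilde C\in\mathbb Z_{p^{k+s}}$, $\widetilde C\equiv C\pmod{p^k}$, is given by the eigenvalue in $$U_N(B(s))\psi=e\Big(\frac{r\widetilde C}{p^{k+s}}\Big)\psi,\qquad B(s)=\begin{pmatrix}1+rDp^{2(k-s)}&p^{k-s}D\\p^{k-s}&1+rDp^{2(k-s)}\end{pmatrix}\in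 H_D,$$ and there are complex numbers $\alpha_\psi(b),\beta_\psi(b)$ with $|\alpha_\psi(b)|=|\beta_\psi(b)|=1$ such that $$\psi(b)=\frac{1}{\sqrt{1-\left(\frac Dp\right)\frac1p}}\left(\alpha_\psi(b)\sum_{z=1}^{p^s}e\Big(\frac{q_+(z)}{p^s}\Big)+\beta_\psi(b)\sum_{z=1}^{p^s}e\Big(\frac{q_-(z)}{p^s}\Big)\right),$$ where $q_\pm(z)=r\left(\Theta_\psi(b)z\pm x_0Dbz^2+p^{k-2s}3^{-1}D^2b^2z^3\right)$. -/

import Mathlib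

namespace CatMap

open Matrix

/-- The state space `L²(ℤ/N)`, as a space of functions. -/
abbrev State (N : ℕ) : Type := ZMod N → ℂ

/-- The squared norm of `L²(ℤ/N)`, for the inner product `(1/N) ∑ φ(Q) conj ψ(Q)`. -/
noncomputable def normSq {N : ℕ} [NeZero N] (ψ : State N) : ℝ :=
  (1 / (N : ℝ)) * ∑ x : ZMod N, ‖ψ x‖ ^ 2

section Weil

variable {N : ℕ} [NeZero N]

/-- The operator of `n_b = (1 b; 0 1)`: `ψ(x) ↦ e(r b x² / N) ψ(x)`, where `2 r = 1` in `ℤ/N`.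
Here `ZMod.stdAddChar (j : ZMod N) = exp (2 π i j / N)`. -/
noncomputable def opN (b : ZMod N) : State N →ₗ[ℂ] State N where
  toFun ψ := fun x => ZMod.stdAddChar ((2 : ZMod N)⁻¹ * b * x ^ 2) * ψ x
  map_add' ψ φ := by funext x; simp [mul_add]
  map_smul' c ψ := by funext x; simp; ring

/-- The operator of `a_t = (t 0; 0 t⁻¹)`: `ψ(x) ↦ ψ(t x)`.
(The sign `Λ(t)` is `1`, because `N` will be an even power of an odd prime.) -/
def opA (t : ZMod N) : State N →ₗ[ℂ] State N where
  toFun ψ := fun x => ψ (t * x)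
  map_add' ψ φ := by funext x; simp
  map_smul' c ψ := by funext x; simp

/-- The operator of `ω = (0 1; -1 0)`: `ψ(x) ↦ N^(-1/2) ∑ ψ(y) e(2 r x y / N)`, where `2 r = 1`.
(The normalized Gauss sum `S_r(-1, N)` is `1`, because `N` will be an even power of an odd
prime.) -/
noncomputable def opW : State N →ₗ[ℂ] State N where
  toFun ψ := fun x =>
    ((Real.sqrt N : ℝ) : ℂ)⁻¹ *
      ∑ y : ZMod N, ψ y * ZMod.stdAddChar (2 * (2 : ZMod N)⁻¹ * x * y)
  map_add' ψ φ := by funext x; simp [add_mul, Finset.sum_add_distrib, mul_add]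
  map_smul' c ψ := by
    funext x; simp only [Pi.smul_apply, smul_eq_mul, RingHom.id_apply, Finset.mul_sum]
    exact Finset.sum_congr rfl fun y _ => by ring

/-- The unipotent matrix `n_b`. -/
def matN (b : ZMod N) : SpecialLinearGroup (Fin 2) (ZMod N) :=
  ⟨!![1, b; 0, 1], by simp [Matrix.det_fin_two_of]⟩

/-- The diagonal matrix `a_t`. -/
def matA (t : (ZMod N)ˣ) : SpecialLinearGroup (Fin 2) (ZMod N) :=
  ⟨!![(t : ZMod N), 0; 0, ((t⁻¹ : (ZMod N)ˣ) : ZMod N)], by simp [Matrix.det_fin_two_of]⟩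

/-- The matrix `ω`. -/
def matW : SpecialLinearGroup (Fin 2) (ZMod N) :=
  ⟨!![0, 1; -1, 0], by simp [Matrix.det_fin_two_of]⟩

/-- The operator of a matrix `(a b; c d)` with `c` a unit, through the factorization
`(a b; c d) = n_{a/c} ω n_{c d} a_{-c}`. -/
noncomputable def weilCell (g : SpecialLinearGroup (Fin 2) (ZMod N)) : State N →ₗ[ℂ] State N :=
  opN (g.1 0 0 * (g.1 1 0)⁻¹) * opW * opN (g.1 1 0 * g.1 1 1) * opA (-(g.1 1 0))

open Classical in
/-- The quantization `U_N` (the Weil representation of `SL(2, ℤ/N)` on `L²(ℤ/N)`) for `N` an even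
power of an odd prime.  If the lower left entry of `g` is not a unit then that of `ω g` is one,
and `g = a_{-1} ω (ω g)`.  Below, `weil_mul`, `weil_matN`, `weil_matA` and `weil_matW` show that
this is the representation with the prescribed values on the generators `n_b`, `a_t`, `ω`. -/
noncomputable def weil (g : SpecialLinearGroup (Fin 2) (ZMod N)) : State N →ₗ[ℂ] State N :=
  if IsUnit (g.1 1 0) then weilCell g else opA (-1) * opW * weilCell (matW * g)

/-- The group `H_D` of matrices `(a bD; b a)` of determinant one. -/
def heckeGroup (D : ZMod N) : Set (SpecialLinearGroup (Fin 2) (ZMod N)) :=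
  {g | ∃ a b : ZMod N, g.1 = !![a, b * D; b, a]}

/-- `ψ` is a normalized Hecke eigenfunction: a unit vector that is a joint eigenvector of all
the Hecke operators `U_N(h)`, `h ∈ H_D`. -/
def IsNormalizedHeckeEigenfunction (D : ZMod N) (ψ : State N) : Prop :=
  normSq ψ = 1 ∧ ∀ h ∈ heckeGroup D, ∃ c : ℂ, weil h ψ = c • ψ

end Weil

section PrimePower

variable (p k : ℕ) [Fact p.Prime]

/-- `ζ_x = ∑_{t mod p^k} e(x₁ t / p^k) δ_{x₂ + p^k t}`, a function on `ℤ/p^{2k}`. -/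
noncomputable def zeta (x : Fin 2 → ZMod (p ^ (2 * k))) : State (p ^ (2 * k)) :=
  ∑ t : ZMod (p ^ k), (ZMod.stdAddChar ((x 0).cast * t) : ℂ) •
    (Pi.single (x 1 + (p : ZMod (p ^ (2 * k))) ^ k * t.cast) 1 : State (p ^ (2 * k)))

/-- `V_C`, the span of the `ζ_x` with `x₁² - D x₂² = -C` in `ℤ/p^k`.  (The line spanned by `ζ_x`
depends on `x` modulo `p^k` only.) -/
noncomputable def V (D : ZMod (p ^ (2 * k))) (C : ZMod (p ^ k)) :
    Submodule ℂ (State (p ^ (2 * k))) :=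
  Submodule.span ℂ {f | ∃ x : Fin 2 → ZMod (p ^ (2 * k)),
    ((x 0 ^ 2 - D * x 1 ^ 2).cast : ZMod (p ^ k)) = -C ∧ f = zeta p k x}

/-- `Θ ∈ ℤ/p^s` is the value `Θ_ψ(b)`: with `r = 1/2`, it satisfies
`Θ p^k ≡ -x₀² p^{2s} - C' + D b² - p^{2(k-s)} 3⁻¹ r D² b² (mod p^{k+s})`,
where `C' ∈ ℤ/p^{k+s}`, `C' ≡ C (mod p^k)`, is read off from the eigenvalue,
`U_N(B(s)) ψ = e(r C' / p^{k+s}) ψ`, of the Hecke operator of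
`B(s) = (1 + r D p^{2(k-s)}, p^{k-s} D; p^{k-s}, 1 + r D p^{2(k-s)})`. -/
def IsTheta (s : ℕ) (D : ZMod (p ^ (2 * k))) (C : ZMod (p ^ k)) (ψ : State (p ^ (2 * k)))
    (b : ZMod (p ^ (2 * k))) (x₀ : ℤ) (Θ : ZMod (p ^ s)) : Prop :=
  ∃ C' : ZMod (p ^ (k + s)),
    (C'.cast : ZMod (p ^ k)) = C ∧
    (∃ B ∈ heckeGroup D,
      B.1 = !![1 + 2⁻¹ * D * (p : ZMod (p ^ (2 * k))) ^ (2 * (k - s)),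
                  (p : ZMod (p ^ (2 * k))) ^ (k - s) * D;
               (p : ZMod (p ^ (2 * k))) ^ (k - s),
                  1 + 2⁻¹ * D * (p : ZMod (p ^ (2 * k))) ^ (2 * (k - s))] ∧
      weil B ψ = (ZMod.stdAddChar (2⁻¹ * C') : ℂ) • ψ) ∧
    (Θ.cast : ZMod (p ^ (k + s))) * (p : ZMod (p ^ (k + s))) ^ k =
      -(x₀ : ZMod (p ^ (k + s))) ^ 2 * (p : ZMod (p ^ (k + s))) ^ (2 * s) - C'
        + D.cast * b.cast ^ 2
        - (p : ZMod (p ^ (k + s))) ^ (2 * (k - s)) * 3⁻¹ * 2⁻¹ * D.cast ^ 2 * b.cast ^ 2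

/-- The cubic polynomials
`q_±(z) = r (Θ z ± x₀ D b z² + p^{k-2s} 3⁻¹ D² b² z³)` on `ℤ/p^s`, with `r = 1/2`
and with the sign `σ = ±1`. -/
def cubic (s : ℕ) (D b : ZMod (p ^ (2 * k))) (x₀ : ℤ) (Θ : ZMod (p ^ s)) (σ : ℤ)
    (z : ZMod (p ^ s)) : ZMod (p ^ s) :=
  2⁻¹ * (Θ * z + (σ : ZMod (p ^ s)) * x₀ * D.cast * b.cast * z ^ 2
    + (p : ZMod (p ^ s)) ^ (k - 2 * s) * 3⁻¹ * D.cast ^ 2 * b.cast ^ 2 * z ^ 3)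

/-- The complete exponential sum `∑_{z=1}^{p^s} e(q(z) / p^s)`. -/
noncomputable def expSum (s : ℕ) (q : ZMod (p ^ s) → ZMod (p ^ s)) : ℂ :=
  ∑ z ∈ Finset.Icc 1 (p ^ s), ZMod.stdAddChar (q (z : ZMod (p ^ s)))

end PrimePower

section WeilLaws

variable {p k : ℕ}

lemma val_mul (g h : SpecialLinearGroup (Fin 2) (ZMod (p ^ (2 * k)))) :
    (g * h).1 = g.1 * h.1 := rfl

lemma pk_pk : (p : ZMod (p ^ (2 * k))) ^ k * (p : ZMod (p ^ (2 * k))) ^ k = 0 := by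
  rw [← pow_add, ← two_mul]; exact_mod_cast ZMod.natCast_self (p ^ (2 * k))

lemma sqrt_eq : ((Real.sqrt ((p ^ (2 * k) : ℕ) : ℝ) : ℝ) : ℂ) = (p : ℂ) ^ k := by
  have : ((p ^ (2 * k) : ℕ) : ℝ) = ((p : ℝ) ^ k) ^ 2 := by push_cast; ring
  rw [this, Real.sqrt_sq (by positivity)]; push_cast; rfl

variable [Fact p.Prime]

lemma two_unit (hp : p ≠ 2) (n : ℕ) : (2 : ZMod (p ^ n))⁻¹ * 2 = 1 := by
  have h : Nat.Coprime 2 (p ^ n) :=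
    Nat.Coprime.pow_right _ ((Nat.coprime_primes Nat.prime_two Fact.out).2 (Ne.symm hp))
  have := ZMod.coe_mul_inv_eq_one 2 h
  rw [mul_comm]; exact_mod_cast this

lemma dvd_aux (n : ℕ) : p ^ (2 * k) ∣ p ^ k * n ↔ p ^ k ∣ n := by
  rw [two_mul, pow_add]
  exact Nat.mul_dvd_mul_iff_left (pow_pos (Fact.out : p.Prime).pos k)

lemma pk_mul_eq_zero {w : ZMod (p ^ (2 * k))} (h : (p : ZMod (p ^ (2 * k))) ^ k * w = 0) :
    ∃ u : ℕ, w = (p : ZMod (p ^ (2 * k))) ^ k * (u : ZMod (p ^ (2 * k))) := by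
  have hw : w = ((w.val : ℕ) : ZMod (p ^ (2 * k))) := by simp
  rw [hw, ← Nat.cast_pow, ← Nat.cast_mul, ZMod.natCast_eq_zero_iff, dvd_aux] at h
  obtain ⟨u, hu⟩ := h
  exact ⟨u, by rw [hw, hu]; push_cast; ring⟩

lemma sq_zero {w : ZMod (p ^ (2 * k))} (h : (p : ZMod (p ^ (2 * k))) ^ k * w = 0) :
    w ^ 2 = 0 := by
  obtain ⟨u, rfl⟩ := pk_mul_eq_zero h
  linear_combination ((u : ZMod (p ^ (2 * k))) ^ 2) * (pk_pk (p := p) (k := k))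

lemma char_cast (a : ZMod (p ^ (2 * k))) (t : ZMod (p ^ k)) :
    (ZMod.stdAddChar ((a.cast : ZMod (p ^ k)) * t) : ℂ) =
      ZMod.stdAddChar (a * ((p : ZMod (p ^ (2 * k))) ^ k * t.cast)) := by
  have hp0 : (p : ℂ) ≠ 0 := by exact_mod_cast (Fact.out : p.Prime).ne_zero
  have h1 : (a.cast : ZMod (p ^ k)) * t = (((a.val * t.val : ℕ) : ℤ) : ZMod (p ^ k)) := by
    push_cast; rw [ZMod.natCast_val, ZMod.natCast_zmod_val]
  have h2 : a * ((p : ZMod (p ^ (2 * k))) ^ k * t.cast) =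
      (((a.val * (p ^ k * t.val) : ℕ) : ℤ) : ZMod (p ^ (2 * k))) := by
    push_cast; rw [ZMod.natCast_val t, ZMod.natCast_zmod_val]
  rw [h1, h2, ZMod.stdAddChar_coe, ZMod.stdAddChar_coe]
  congr 1
  push_cast
  have e : (p : ℂ) ^ (2 * k) = (p : ℂ) ^ k * (p : ℂ) ^ k := by rw [two_mul, pow_add]
  rw [e]
  field_simp

lemma zeta_apply (x : Fin 2 → ZMod (p ^ (2 * k))) (y : ZMod (p ^ (2 * k))) :
    zeta p k x y = if (p : ZMod (p ^ (2 * k))) ^ k * (y - x 1) = 0 then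
      (ZMod.stdAddChar (x 0 * (y - x 1)) : ℂ) else 0 := by
  classical
  have key : zeta p k x y = ∑ t : ZMod (p ^ k),
      if y = x 1 + (p : ZMod (p ^ (2 * k))) ^ k * t.cast then
        (ZMod.stdAddChar (x 0 * (y - x 1)) : ℂ) else 0 := by
    simp only [zeta, Finset.sum_apply, Pi.smul_apply, smul_eq_mul, Pi.single_apply, mul_ite,
      mul_one, mul_zero]
    refine Finset.sum_congr rfl fun t _ => ?_
    split_ifs with h
    · rw [char_cast, h]; congr 2; ring
    · rfl
  rw [key]
  split_ifs with h
  · obtain ⟨u, hu⟩ := pk_mul_eq_zero h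
    rw [Finset.sum_eq_single ((u : ZMod (p ^ k)))]
    · rw [if_pos]
      have hc : (p : ZMod (p ^ (2 * k))) ^ k * ((u : ZMod (p ^ k)).cast : ZMod (p ^ (2 * k))) =
          (p : ZMod (p ^ (2 * k))) ^ k * u := by
        rw [← ZMod.natCast_val, ZMod.val_natCast]
        have := Nat.div_add_mod u (p ^ k)
        have e : (u : ZMod (p ^ (2 * k))) =
            (p : ZMod (p ^ (2 * k))) ^ k * ((u / p ^ k : ℕ) : ZMod (p ^ (2 * k))) +
              ((u % p ^ k : ℕ) : ZMod (p ^ (2 * k))) := by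
          exact_mod_cast congrArg (Nat.cast : ℕ → ZMod (p ^ (2 * k))) this.symm
        linear_combination (-(p : ZMod (p ^ (2 * k))) ^ k) * e -
          ((u / p ^ k : ℕ) : ZMod (p ^ (2 * k))) * (pk_pk (p := p) (k := k))
      linear_combination hu - hc
    · intro t _ ht
      rw [if_neg]
      intro hy
      apply ht
      have e : (p : ZMod (p ^ (2 * k))) ^ k * (t.val : ZMod (p ^ (2 * k))) =
          (p : ZMod (p ^ (2 * k))) ^ k * u := by
        rw [ZMod.natCast_val]; linear_combination hu - hy
      have e2 : ((p ^ k * t.val : ℕ) : ZMod (p ^ (2 * k))) = ((p ^ k * u : ℕ) : _) := by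
        push_cast; exact e
      rw [ZMod.natCast_eq_natCast_iff, two_mul, pow_add] at e2
      have e3 := Nat.ModEq.mul_left_cancel' (pow_pos (Fact.out : p.Prime).pos k).ne' e2
      rw [← ZMod.natCast_eq_natCast_iff] at e3
      simpa using e3
    · simp
  · apply Finset.sum_eq_zero
    intro t _
    rw [if_neg]
    intro hy
    apply h
    linear_combination (p : ZMod (p ^ (2 * k))) ^ k * hy +
      (t.cast : ZMod (p ^ (2 * k))) * (pk_pk (p := p) (k := k))

lemma sum_char (a : ZMod (p ^ (2 * k))) :
    ∑ t : ZMod (p ^ k), (ZMod.stdAddChar (a * ((p : ZMod (p ^ (2 * k))) ^ k * t.cast)) : ℂ) =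
      if (p : ZMod (p ^ (2 * k))) ^ k * a = 0 then (p : ℂ) ^ k else 0 := by
  classical
  simp_rw [← char_cast]
  have h := AddChar.sum_mulShift (R := ZMod (p ^ k)) (R' := ℂ) (a.cast : ZMod (p ^ k))
    (ZMod.isPrimitive_stdAddChar (p ^ k))
  simp_rw [mul_comm _ (a.cast : ZMod (p ^ k))] at h
  rw [h, ZMod.card]
  have : (a.cast : ZMod (p ^ k)) = 0 ↔ (p : ZMod (p ^ (2 * k))) ^ k * a = 0 := by
    have hw : a = ((a.val : ℕ) : ZMod (p ^ (2 * k))) := by simp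
    rw [← ZMod.natCast_val, ZMod.natCast_eq_zero_iff]
    conv_rhs => rw [hw, ← Nat.cast_pow, ← Nat.cast_mul, ZMod.natCast_eq_zero_iff, dvd_aux]
  simp only [this]
  push_cast
  rfl

def Acts (T : State (p ^ (2 * k)) →ₗ[ℂ] State (p ^ (2 * k)))
    (g : SpecialLinearGroup (Fin 2) (ZMod (p ^ (2 * k)))) : Prop :=
  ∀ x : Fin 2 → ZMod (p ^ (2 * k)), T (zeta p k x) =
    (ZMod.stdAddChar (2⁻¹ * ((g.1 *ᵥ x) 0 * (g.1 *ᵥ x) 1 - x 0 * x 1)) : ℂ) •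
      zeta p k (g.1 *ᵥ x)

lemma Acts.mul {T S : State (p ^ (2 * k)) →ₗ[ℂ] State (p ^ (2 * k))}
    {g h : SpecialLinearGroup (Fin 2) (ZMod (p ^ (2 * k)))} (hT : Acts T g) (hS : Acts S h) :
    Acts (T * S) (g * h) := by
  intro x
  rw [Module.End.mul_apply, hS x, map_smul, hT, smul_smul, val_mul,
    ← Matrix.mulVec_mulVec, ← AddChar.map_add_eq_mul]
  congr 2
  ring

lemma acts_N (hp : p ≠ 2) (b : ZMod (p ^ (2 * k))) : Acts (opN b) (matN b) := by
  intro x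
  have h2 := two_unit hp (2 * k)
  funext y
  simp only [opN, matN, LinearMap.coe_mk, AddHom.coe_mk, Pi.smul_apply, smul_eq_mul, zeta_apply,
    Matrix.mulVec, dotProduct, Fin.sum_univ_two, Matrix.of_apply, Matrix.cons_val_zero,
    Matrix.cons_val_one, one_mul, zero_mul, zero_add]
  split_ifs with h
  · rw [← AddChar.map_add_eq_mul, ← AddChar.map_add_eq_mul]
    congr 1
    linear_combination 2⁻¹ * b * sq_zero h + b * x 1 * (y - x 1) * h2
  · simp

lemma acts_A (t : (ZMod (p ^ (2 * k)))ˣ) : Acts (opA (t : ZMod (p ^ (2 * k)))) (matA t) := by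
  intro x
  have ht : (t : ZMod (p ^ (2 * k))) * ((t⁻¹ : (ZMod (p ^ (2 * k)))ˣ) : ZMod (p ^ (2 * k))) = 1 :=
    t.mul_inv
  funext y
  simp only [opA, matA, LinearMap.coe_mk, AddHom.coe_mk, Pi.smul_apply, smul_eq_mul, zeta_apply,
    Matrix.mulVec, dotProduct, Fin.sum_univ_two, Matrix.of_apply, Matrix.cons_val_zero,
    Matrix.cons_val_one, zero_mul, zero_add, add_zero]
  set u := ((t⁻¹ : (ZMod (p ^ (2 * k)))ˣ) : ZMod (p ^ (2 * k)))
  have e1 : (p : ZMod (p ^ (2 * k))) ^ k * (t * y - x 1) = 0 ↔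
      (p : ZMod (p ^ (2 * k))) ^ k * (y - u * x 1) = 0 := by
    constructor
    · intro h; linear_combination u * h - (p : ZMod (p ^ (2 * k))) ^ k * y * ht
    · intro h
      linear_combination (t : ZMod (p ^ (2 * k))) * h + (p : ZMod (p ^ (2 * k))) ^ k * x 1 * ht
  simp only [e1]
  split_ifs with h
  · rw [← AddChar.map_add_eq_mul]
    congr 1
    linear_combination (x 0 * x 1 - 2⁻¹ * x 0 * x 1) * ht
  · simp

lemma acts_W (hp : p ≠ 2) : Acts (p := p) (k := k) opW matW := by
  intro x
  have h2 := two_unit hp (2 * k)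
  have hp0 : (p : ℂ) ≠ 0 := by exact_mod_cast (Fact.out : p.Prime).ne_zero
  funext y
  have key : ∑ z : ZMod (p ^ (2 * k)), zeta p k x z *
      (ZMod.stdAddChar (2 * (2 : ZMod (p ^ (2 * k)))⁻¹ * y * z) : ℂ) =
      ZMod.stdAddChar (y * x 1) *
        if (p : ZMod (p ^ (2 * k))) ^ k * (x 0 + y) = 0 then (p : ℂ) ^ k else 0 := by
    rw [← sum_char, Finset.mul_sum]
    simp only [zeta, Finset.sum_apply, Pi.smul_apply, smul_eq_mul, Pi.single_apply, mul_ite,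
      mul_one, mul_zero, Finset.sum_mul, ite_mul, zero_mul]
    rw [Finset.sum_comm]
    refine Finset.sum_congr rfl fun t _ => ?_
    rw [Finset.sum_ite_eq' Finset.univ, if_pos (Finset.mem_univ _), char_cast,
      ← AddChar.map_add_eq_mul, ← AddChar.map_add_eq_mul]
    congr 1
    linear_combination y * (x 1 + (p : ZMod (p ^ (2 * k))) ^ k * t.cast) * h2
  simp only [opW, matW, LinearMap.coe_mk, AddHom.coe_mk, Pi.smul_apply, smul_eq_mul]
  rw [key, sqrt_eq, zeta_apply]
  simp only [Matrix.mulVec, dotProduct, Fin.sum_univ_two, Matrix.of_apply, Matrix.cons_val_zero,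
    Matrix.cons_val_one, zero_mul, zero_add, add_zero, one_mul, neg_mul, sub_neg_eq_add]
  rw [add_comm (x 0) y]
  split_ifs with h
  · rw [mul_comm, mul_assoc, mul_inv_cancel₀ (pow_ne_zero _ hp0), mul_one,
      ← AddChar.map_add_eq_mul]
    congr 1
    linear_combination (x 0 * x 1) * h2
  · simp

lemma zeta_span : Submodule.span ℂ (Set.range (zeta p k)) = ⊤ := by
  rw [eq_top_iff, ← (Pi.basisFun ℂ (ZMod (p ^ (2 * k)))).span_eq, Submodule.span_le]
  rintro _ ⟨y, rfl⟩
  have hp0 : (p : ℂ) ≠ 0 := by exact_mod_cast (Fact.out : p.Prime).ne_zero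
  have key : (Pi.basisFun ℂ (ZMod (p ^ (2 * k))) y : State (p ^ (2 * k))) =
      ((p : ℂ) ^ (2 * k))⁻¹ • ∑ a : ZMod (p ^ (2 * k)), zeta p k ![a, y] := by
    funext z
    simp only [Pi.basisFun_apply, Pi.smul_apply, Finset.sum_apply, smul_eq_mul, zeta_apply,
      Matrix.cons_val_zero, Matrix.cons_val_one, Pi.single_apply]
    by_cases hz : (p : ZMod (p ^ (2 * k))) ^ k * (z - y) = 0
    · simp only [hz, if_true]
      rw [AddChar.sum_mulShift (R := ZMod (p ^ (2 * k))) (R' := ℂ) (z - y)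
        (ZMod.isPrimitive_stdAddChar (p ^ (2 * k))), ZMod.card]
      by_cases hzy : z = y
      · simp [hzy, hp0]
      · simp [hzy, sub_eq_zero]
    · have hzy : z ≠ y := by rintro rfl; simp at hz
      simp [hz, hzy]
  rw [key]
  exact Submodule.smul_mem _ _ (Submodule.sum_mem _ fun a _ => Submodule.subset_span ⟨_, rfl⟩)

lemma Acts.unique {T S : State (p ^ (2 * k)) →ₗ[ℂ] State (p ^ (2 * k))}
    {g : SpecialLinearGroup (Fin 2) (ZMod (p ^ (2 * k)))} (hT : Acts T g) (hS : Acts S g) :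
    T = S := by
  refine LinearMap.ext_on zeta_span ?_
  rintro _ ⟨x, rfl⟩
  rw [hT x, hS x]

lemma acts_cell (hp : p ≠ 2) (g : SpecialLinearGroup (Fin 2) (ZMod (p ^ (2 * k))))
    (hg : IsUnit (g.1 1 0)) : Acts (weilCell g) g := by
  obtain ⟨c, hc⟩ := hg
  have hcc : (g.1 1 0)⁻¹ = ((c⁻¹ : (ZMod (p ^ (2 * k)))ˣ) : ZMod (p ^ (2 * k))) := by
    rw [← hc]; exact ZMod.inv_coe_unit c
  have e : g = matN (g.1 0 0 * (g.1 1 0)⁻¹) * matW * matN (g.1 1 0 * g.1 1 1) * matA (-c) := by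
    have hd := g.2
    rw [Matrix.det_fin_two] at hd
    have h1 : g.1 1 0 * (g.1 1 0)⁻¹ = 1 := by rw [hcc, ← hc]; exact c.mul_inv
    have h3 : (((-c)⁻¹ : (ZMod (p ^ (2 * k)))ˣ) : ZMod (p ^ (2 * k))) = -(g.1 1 0)⁻¹ := by
      rw [hcc, inv_neg, Units.val_neg]
    apply Subtype.ext
    simp only [val_mul]
    simp only [matN, matW, matA, h3, Units.val_neg, hc]
    generalize (g.1 1 0)⁻¹ = v at *
    ext i j
    fin_cases i <;> fin_cases j <;> simp [Matrix.mul_apply, Fin.sum_univ_two]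
    · linear_combination (-g.1 0 0) * h1
    · linear_combination (-v) * hd - (g.1 0 1 + g.1 0 0 * g.1 1 1 * v) * h1
    · linear_combination (-g.1 1 1) * h1
  have := (((acts_N (k := k) hp (g.1 0 0 * (g.1 1 0)⁻¹)).mul (acts_W hp)).mul
    (acts_N hp (g.1 1 0 * g.1 1 1))).mul (acts_A (-c))
  rw [← e, Units.val_neg, hc] at this
  exact this

lemma acts_weil (hp : p ≠ 2) (g : SpecialLinearGroup (Fin 2) (ZMod (p ^ (2 * k)))) :
    Acts (weil g) g := by
  unfold weil
  split_ifs with hg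
  · exact acts_cell hp g hg
  · have hu : IsUnit ((matW * g).1 1 0) := by
      have e : (matW * g).1 1 0 = -g.1 0 0 := by
        rw [val_mul]; simp [matW, Matrix.mul_apply, Fin.sum_univ_two]
      rw [e, IsUnit.neg_iff]
      have hd := g.2
      rw [Matrix.det_fin_two] at hd
      have hpu : ∀ a : ZMod (p ^ (2 * k)), ¬ IsUnit a → ¬ IsUnit (1 + a) → False := by
        intro a ha ha'
        rcases Nat.eq_zero_or_pos k with rfl | hk
        · have : Subsingleton (ZMod (p ^ (2 * 0))) := by
            change Subsingleton (ZMod 1); infer_instance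
          exact ha (isUnit_of_subsingleton a)
        · have key : ∀ n : ℕ, ¬ IsUnit (n : ZMod (p ^ (2 * k))) → p ∣ n := by
            intro n hn
            by_contra hpn
            exact hn ((ZMod.isUnit_iff_coprime n _).2 (Nat.Coprime.pow_right _
              (Nat.coprime_comm.1 (((Fact.out : p.Prime).coprime_iff_not_dvd).2 hpn))))
          have h1 := key a.val (by simpa using ha)
          have h2 := key (1 + a.val) (by simpa using ha')
          have h3 := (Nat.dvd_add_left h1).1 h2
          exact (Fact.out : p.Prime).one_lt.ne' (Nat.dvd_one.1 h3)
      by_contra h00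
      refine hpu (g.1 0 1 * g.1 1 0) (fun h => hg (isUnit_of_mul_isUnit_right h)) ?_
      rw [show 1 + g.1 0 1 * g.1 1 0 = g.1 0 0 * g.1 1 1 by linear_combination -hd]
      exact fun h => h00 (isUnit_of_mul_isUnit_left h)
    have := ((acts_A (p := p) (k := k) (-1)).mul (acts_W hp)).mul (acts_cell hp (matW * g) hu)
    have e : matA (-1) * matW * (matW * g) = g := by
      have h1 : (matA (-1) * matW * matW : SpecialLinearGroup (Fin 2) (ZMod (p ^ (2 * k)))) = 1 := by
        apply Subtype.ext
        rw [val_mul, val_mul]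
        ext i j
        fin_cases i <;> fin_cases j <;> simp [matA, matW, Matrix.mul_apply, Fin.sum_univ_two]
      rw [← mul_assoc, h1, one_mul]
    rw [e, Units.val_neg, Units.val_one] at this
    exact this

/-- `U_N` is multiplicative. -/
theorem weil_mul (hp : p ≠ 2) (g h : SpecialLinearGroup (Fin 2) (ZMod (p ^ (2 * k)))) :
    weil (g * h) = weil g * weil h :=
  (acts_weil hp _).unique ((acts_weil hp g).mul (acts_weil hp h))

/-- The value of `U_N` on `n_b`. -/
theorem weil_matN (hp : p ≠ 2) (b : ZMod (p ^ (2 * k))) : weil (matN b) = opN b :=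
  (acts_weil hp _).unique (acts_N hp b)

/-- The value of `U_N` on `a_t`. -/
theorem weil_matA (hp : p ≠ 2) (t : (ZMod (p ^ (2 * k)))ˣ) :
    weil (matA t) = opA (t : ZMod (p ^ (2 * k))) :=
  (acts_weil hp _).unique (acts_A t)

/-- The value of `U_N` on `ω`. -/
theorem weil_matW (hp : p ≠ 2) :
    weil (matW : SpecialLinearGroup (Fin 2) (ZMod (p ^ (2 * k)))) = opW :=
  (acts_weil hp _).unique (acts_W hp)

end WeilLaws

end CatMap

namespace CatMap

open Matrix

/-! ### Reduction between powers of `p`, and characters -/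

section Reduction

variable {p m n : ℕ}

/-! The vectors `ζ_x`, with `x` taken modulo `p^k`, behave like an orthogonal basis that `U_N(g)`
permutes by `x ↦ g x`, up to explicit phases. So `ψ` is studied through its coefficients `coeff x
ψ`, and `ψ(b)` is the sum of the coefficients at `(a, b)` over `a` modulo `p^k`
(`apply_eq_sum_coeff`). For `ψ ∈ V_C` only the roots `a` of `a² = -C + D b²` contribute.

Modulus. `H_D` acts transitively on the conic `x₁² - D x₂² = -C` modulo `p^k`, and Hecke eigenvalues
are roots of unity, so all coefficients on the conic have the same modulus (`norm_coeff_eq`).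
Parseval and a count of the points of the conic determine it: this is the factor `(1 -
(D/p)/p)^(-1/2)` (`norm_coeff`).

Phase. Modulo `p^k`, the power `B(s)^z` sends `(± x₀ p^s, b)` to `(± x₀ p^s + p^(k-s) z D b, b)`.
Since `D b` is a unit modulo `p^s`, the values `1 ≤ z ≤ p^s` run through all roots of the given
sign. Comparing the eigenvalue of `B(s)^z` with the phase in the Weil action shows that the
coefficients along this orbit vary by a cubic phase in `z` with linear coefficient `r Θ`
(`coeff_orbit`).

Conclusion. The orbit cubic has the form `r (Θ z ∓ x₀ D b z² - p^(k-2s) 3⁻¹ D² b² z³)`, whose signs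
differ from those of `cubic`. The two polynomials need not be matched: any cubic sum modulo `p^s`
with unit quadratic coefficient and cubic coefficient divisible by `p` has modulus `p^(s/2)`
(`norm_sq_cubic_sum`). Hence each half of `ψ(b)` has the modulus of the corresponding half of the
formula, and `α`, `β` are the quotients. -/

lemma cast_add_of_le (h : m ≤ n) (a b : ZMod (p ^ n)) :
    ((a + b).cast : ZMod (p ^ m)) = a.cast + b.cast := ZMod.cast_add (pow_dvd_pow p h) a b

lemma cast_mul_of_le (h : m ≤ n) (a b : ZMod (p ^ n)) :
    ((a * b).cast : ZMod (p ^ m)) = a.cast * b.cast := ZMod.cast_mul (pow_dvd_pow p h) a b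

lemma isUnit_cast (h : m ≤ n) {a : ZMod (p ^ n)} (ha : IsUnit a) :
    IsUnit (a.cast : ZMod (p ^ m)) := by
  rw [← ZMod.castHom_apply (h := pow_dvd_pow p h)]
  exact ha.map _

lemma isUnit_pow_zero (a : ZMod (p ^ 0)) : IsUnit a := by
  have : Subsingleton (ZMod (p ^ 0)) := by
    change Subsingleton (ZMod 1)
    infer_instance
  exact isUnit_of_subsingleton _

variable [Fact p.Prime]

lemma cast_cast_of_le (h : m ≤ n) (a : ZMod (p ^ m)) :
    ((a.cast : ZMod (p ^ n)).cast : ZMod (p ^ m)) = a := by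
  rw [← ZMod.natCast_val a, ZMod.cast_natCast (pow_dvd_pow p h), ZMod.natCast_zmod_val]

/-- Encodes a congruence modulo `p^m` as an equation in `ℤ/p^n`, so that congruences to different
moduli can be combined linearly in one ring. -/
lemma pow_mul_eq_zero_iff (h : m ≤ n) (w : ZMod (p ^ n)) :
    (p : ZMod (p ^ n)) ^ (n - m) * w = 0 ↔ (w.cast : ZMod (p ^ m)) = 0 := by
  have hw : w = ((w.val : ℕ) : ZMod (p ^ n)) := by simp
  rw [← ZMod.natCast_val w, ZMod.natCast_eq_zero_iff]
  conv_lhs => rw [hw]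
  rw [← Nat.cast_pow, ← Nat.cast_mul, ZMod.natCast_eq_zero_iff]
  have e : p ^ n = p ^ (n - m) * p ^ m := by rw [← pow_add, Nat.sub_add_cancel h]
  generalize w.val = v
  rw [e]
  exact Nat.mul_dvd_mul_iff_left (pow_pos (Fact.out : p.Prime).pos _)

/-- Brings characters of different levels to a common modulus: `e(w / p^m) = e(p^(n-m) w / p^n)`. -/
lemma stdAddChar_cast (h : m ≤ n) (w : ZMod (p ^ n)) :
    (ZMod.stdAddChar (w.cast : ZMod (p ^ m)) : ℂ) =
      ZMod.stdAddChar ((p : ZMod (p ^ n)) ^ (n - m) * w) := by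
  have hp0 : (p : ℂ) ≠ 0 := by exact_mod_cast (Fact.out : p.Prime).ne_zero
  have h1 : (w.cast : ZMod (p ^ m)) = ((w.val : ℤ) : ZMod (p ^ m)) := by
    push_cast; rw [ZMod.natCast_val]
  have h2 : (p : ZMod (p ^ n)) ^ (n - m) * w =
      ((p ^ (n - m) * w.val : ℤ) : ZMod (p ^ n)) := by
    push_cast; rw [ZMod.natCast_zmod_val]
  rw [h1, h2, ZMod.stdAddChar_coe, ZMod.stdAddChar_coe]
  congr 1
  push_cast
  have e : (p : ℂ) ^ n = (p : ℂ) ^ (n - m) * (p : ℂ) ^ m := by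
    rw [← pow_add, Nat.sub_add_cancel h]
  rw [e]
  field_simp

lemma isUnit_of_not_dvd_val {a : ZMod (p ^ n)} (ha : ¬ p ∣ a.val) : IsUnit a := by
  rw [← ZMod.natCast_zmod_val a]
  exact (ZMod.isUnit_iff_coprime _ _).2 (Nat.Coprime.pow_right _
    (Nat.coprime_comm.1 (((Fact.out : p.Prime).coprime_iff_not_dvd).2 ha)))

lemma isUnit_natCast {a : ℕ} (ha : ¬ p ∣ a) : IsUnit (a : ZMod (p ^ n)) :=
  (ZMod.isUnit_iff_coprime _ _).2 (Nat.Coprime.pow_right _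
    (Nat.coprime_comm.1 (((Fact.out : p.Prime).coprime_iff_not_dvd).2 ha)))

lemma natCast_inv_mul {a : ℕ} (ha : ¬ p ∣ a) : (a : ZMod (p ^ n))⁻¹ * a = 1 :=
  ZMod.inv_mul_of_unit _ (isUnit_natCast ha)

lemma cast_natCast_inv (h : m ≤ n) {a : ℕ} (ha : ¬ p ∣ a) :
    (((a : ZMod (p ^ n))⁻¹).cast : ZMod (p ^ m)) = (a : ZMod (p ^ m))⁻¹ := by
  have h1 : (((a : ZMod (p ^ n))⁻¹).cast : ZMod (p ^ m)) * a = 1 := by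
    have e := congrArg (ZMod.cast : ZMod (p ^ n) → ZMod (p ^ m)) (natCast_inv_mul (n := n) ha)
    rwa [cast_mul_of_le h, ZMod.cast_natCast (pow_dvd_pow p h),
      ZMod.cast_one (pow_dvd_pow p h)] at e
  have h2 := natCast_inv_mul (n := m) ha
  linear_combination (a : ZMod (p ^ m))⁻¹ * h1 - (((a : ZMod (p ^ n))⁻¹).cast : ZMod (p ^ m)) * h2

lemma norm_stdAddChar {N : ℕ} [NeZero N] (a : ZMod N) : ‖(ZMod.stdAddChar a : ℂ)‖ = 1 :=
  AddChar.norm_apply _ _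

/-- Bessel's equality for a sum over the frequencies of distinct points. -/
lemma sum_norm_sq_char {N : ℕ} [NeZero N] {ι : Type*} [Fintype ι] {a : ι → ZMod N}
    (ha : Function.Injective a) (f : ι → ℂ) :
    ∑ x : ZMod N, ‖∑ t, f t * (ZMod.stdAddChar (-(x * a t)) : ℂ)‖ ^ 2 =
      N * ∑ t, ‖f t‖ ^ 2 := by
  classical
  have h : ((∑ x : ZMod N, ‖∑ t, f t * (ZMod.stdAddChar (-(x * a t)) : ℂ)‖ ^ 2 : ℝ) : ℂ) =
      ((N * ∑ t, ‖f t‖ ^ 2 : ℝ) : ℂ) := by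
    push_cast
    simp_rw [← Complex.mul_conj', map_sum, map_mul, ← AddChar.map_neg_eq_conj, neg_neg,
      Finset.sum_mul_sum]
    rw [Finset.sum_comm, Finset.mul_sum]
    refine Finset.sum_congr rfl fun t _ => ?_
    rw [Finset.sum_comm, Finset.sum_eq_single t]
    · have : ∀ x : ZMod N, f t * (ZMod.stdAddChar (-(x * a t)) : ℂ) *
          ((starRingEnd ℂ) (f t) * ZMod.stdAddChar (x * a t)) = f t * (starRingEnd ℂ) (f t) := by
        intro x
        have e : (ZMod.stdAddChar (-(x * a t)) : ℂ) * ZMod.stdAddChar (x * a t) = 1 := by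
          rw [← AddChar.map_add_eq_mul, neg_add_cancel, AddChar.map_zero_eq_one]
        linear_combination f t * (starRingEnd ℂ) (f t) * e
      simp [this, ZMod.card]
    · intro u _ hu
      have : ∀ x : ZMod N, f t * (ZMod.stdAddChar (-(x * a t)) : ℂ) *
          ((starRingEnd ℂ) (f u) * ZMod.stdAddChar (x * a u)) =
          f t * (starRingEnd ℂ) (f u) * ZMod.stdAddChar (x * (a u - a t)) := by
        intro x
        rw [mul_sub, sub_eq_neg_add, AddChar.map_add_eq_mul]
        ring
      simp_rw [this]
      rw [← Finset.mul_sum, AddChar.sum_mulShift (R := ZMod N) (R' := ℂ) (a u - a t)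
        (ZMod.isPrimitive_stdAddChar N), if_neg (sub_ne_zero.2 (ha.ne hu)), Nat.cast_zero,
        mul_zero]
    · simp
  exact_mod_cast h

end Reduction

/-! ### Coefficients with respect to the `ζ_x` -/

section Coeff

variable {p k : ℕ} [Fact p.Prime]

/-- The coefficient functional of `ζ_x`: the inner product with `ζ_x`, normalized by
`‖ζ_x‖² = p ^ (-k)`. -/
noncomputable def coeff (x : Fin 2 → ZMod (p ^ (2 * k))) : State (p ^ (2 * k)) →ₗ[ℂ] ℂ where
  toFun ψ := ((p : ℂ) ^ k)⁻¹ * ∑ t : ZMod (p ^ k),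
    ψ (x 1 + (p : ZMod (p ^ (2 * k))) ^ k * t.cast) *
      ZMod.stdAddChar (-(x 0 * ((p : ZMod (p ^ (2 * k))) ^ k * t.cast)))
  map_add' ψ φ := by simp [add_mul, Finset.sum_add_distrib, mul_add]
  map_smul' c ψ := by
    simp only [Pi.smul_apply, smul_eq_mul, RingHom.id_apply, Finset.mul_sum]
    exact Finset.sum_congr rfl fun y _ => by ring

lemma coeff_apply (x : Fin 2 → ZMod (p ^ (2 * k))) (ψ : State (p ^ (2 * k))) :
    coeff x ψ = ((p : ℂ) ^ k)⁻¹ * ∑ t : ZMod (p ^ k),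
      ψ (x 1 + (p : ZMod (p ^ (2 * k))) ^ k * t.cast) *
        ZMod.stdAddChar (-(x 0 * ((p : ZMod (p ^ (2 * k))) ^ k * t.cast))) := rfl

lemma pow_mul_cast_injective : Function.Injective
    fun t : ZMod (p ^ k) => (p : ZMod (p ^ (2 * k))) ^ k * t.cast := by
  intro t u h
  have h1 : (p : ZMod (p ^ (2 * k))) ^ (2 * k - k) * (t.cast - u.cast) = 0 := by
    rw [show 2 * k - k = k by omega, mul_sub, sub_eq_zero]
    exact h
  rw [pow_mul_eq_zero_iff (by omega), ZMod.cast_sub (pow_dvd_pow p (by omega)),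
    cast_cast_of_le (by omega), cast_cast_of_le (by omega)] at h1
  exact sub_eq_zero.1 h1

/-- Orthogonality: the supports are cosets of `p^k`, and on a common coset the sum over `t` is a
full character sum, detecting whether the first coordinates agree modulo `p^k`. The surviving phase
records the choice of representatives. -/
lemma coeff_zeta (x x' : Fin 2 → ZMod (p ^ (2 * k))) :
    coeff x (zeta p k x') =
      if (p : ZMod (p ^ (2 * k))) ^ k * (x 0 - x' 0) = 0 ∧
          (p : ZMod (p ^ (2 * k))) ^ k * (x 1 - x' 1) = 0 then
        (ZMod.stdAddChar (x' 0 * (x 1 - x' 1)) : ℂ) else 0 := by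
  have hp0 : (p : ℂ) ≠ 0 := by exact_mod_cast (Fact.out : p.Prime).ne_zero
  have hpk := pk_pk (p := p) (k := k)
  have h1 : ∀ t : ZMod (p ^ k), (p : ZMod (p ^ (2 * k))) ^ k *
      (x 1 + (p : ZMod (p ^ (2 * k))) ^ k * t.cast - x' 1) = 0 ↔
      (p : ZMod (p ^ (2 * k))) ^ k * (x 1 - x' 1) = 0 := by
    intro t
    rw [show (p : ZMod (p ^ (2 * k))) ^ k *
      (x 1 + (p : ZMod (p ^ (2 * k))) ^ k * t.cast - x' 1) =
      (p : ZMod (p ^ (2 * k))) ^ k * (x 1 - x' 1) by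
        linear_combination (t.cast : ZMod (p ^ (2 * k))) * hpk]
  simp only [coeff_apply, zeta_apply, h1]
  by_cases h : (p : ZMod (p ^ (2 * k))) ^ k * (x 1 - x' 1) = 0
  · simp only [h, and_true, if_true]
    have h2 : ∀ t : ZMod (p ^ k),
        (ZMod.stdAddChar (x' 0 * (x 1 + (p : ZMod (p ^ (2 * k))) ^ k * t.cast - x' 1)) : ℂ) *
          ZMod.stdAddChar (-(x 0 * ((p : ZMod (p ^ (2 * k))) ^ k * t.cast))) =
        ZMod.stdAddChar (x' 0 * (x 1 - x' 1)) *
          ZMod.stdAddChar ((x' 0 - x 0) * ((p : ZMod (p ^ (2 * k))) ^ k * t.cast)) := by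
      intro t
      rw [← AddChar.map_add_eq_mul, ← AddChar.map_add_eq_mul]
      congr 1
      ring
    have h3 : (p : ZMod (p ^ (2 * k))) ^ k * (x' 0 - x 0) = 0 ↔
        (p : ZMod (p ^ (2 * k))) ^ k * (x 0 - x' 0) = 0 := by
      rw [← neg_sub (x 0), mul_neg, neg_eq_zero]
    simp_rw [h2, ← Finset.mul_sum, sum_char, h3]
    split_ifs
    · field_simp
    · simp
  · simp [h]

lemma linearMap_ext_zeta {M : Type*} [AddCommMonoid M] [Module ℂ M]
    {f g : State (p ^ (2 * k)) →ₗ[ℂ] M} (h : ∀ x, f (zeta p k x) = g (zeta p k x)) : f = g := by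
  refine LinearMap.ext_on zeta_span ?_
  rintro _ ⟨x, rfl⟩
  exact h x

/-- Only the class of `x` modulo `p^k` matters, up to a phase. It suffices to test on the spanning
vectors `ζ_y`, where products of two multiples of `p^k` disappear. -/
lemma coeff_congr {x x' : Fin 2 → ZMod (p ^ (2 * k))}
    (h0 : (p : ZMod (p ^ (2 * k))) ^ k * (x 0 - x' 0) = 0)
    (h1 : (p : ZMod (p ^ (2 * k))) ^ k * (x 1 - x' 1) = 0) (ψ : State (p ^ (2 * k))) :
    coeff x ψ = ZMod.stdAddChar (x 0 * (x 1 - x' 1)) * coeff x' ψ := by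
  suffices coeff x = (ZMod.stdAddChar (x 0 * (x 1 - x' 1)) : ℂ) • coeff x' by rw [this]; rfl
  refine linearMap_ext_zeta fun y => ?_
  obtain ⟨u, hu⟩ := pk_mul_eq_zero h0
  obtain ⟨v, hv⟩ := pk_mul_eq_zero h1
  have hpk := pk_pk (p := p) (k := k)
  rw [LinearMap.smul_apply, coeff_zeta, coeff_zeta, smul_eq_mul]
  have e0 : (p : ZMod (p ^ (2 * k))) ^ k * (x 0 - y 0) =
      (p : ZMod (p ^ (2 * k))) ^ k * (x' 0 - y 0) := by linear_combination h0
  have e1 : (p : ZMod (p ^ (2 * k))) ^ k * (x 1 - y 1) =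
      (p : ZMod (p ^ (2 * k))) ^ k * (x' 1 - y 1) := by linear_combination h1
  rw [e0, e1]
  split_ifs with h
  · obtain ⟨w, hw⟩ := pk_mul_eq_zero h.1
    rw [← AddChar.map_add_eq_mul]
    congr 1
    linear_combination (x 0 - y 0) * (-hv) - (p : ZMod (p ^ (2 * k))) ^ k * v * (hu + hw)
      - (v * (u + w)) * hpk
  · simp

/-- The dual form of `acts_weil`. Tested on `ζ_y` with `x ≡ y` modulo `p^k`, the two phases differ
by terms linear in `x - y`, which cancel because `det g = 1`, and by quadratic terms, which vanish
since `p^(2k) = 0`. -/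
lemma coeff_weil (hp : p ≠ 2) (g : SpecialLinearGroup (Fin 2) (ZMod (p ^ (2 * k))))
    (x : Fin 2 → ZMod (p ^ (2 * k))) (ψ : State (p ^ (2 * k))) :
    coeff (g.1 *ᵥ x) (weil g ψ) =
      ZMod.stdAddChar (2⁻¹ * ((g.1 *ᵥ x) 0 * (g.1 *ᵥ x) 1 - x 0 * x 1)) * coeff x ψ := by
  suffices coeff (g.1 *ᵥ x) ∘ₗ weil g =
      (ZMod.stdAddChar (2⁻¹ * ((g.1 *ᵥ x) 0 * (g.1 *ᵥ x) 1 - x 0 * x 1)) : ℂ) • coeff x from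
    LinearMap.congr_fun this ψ
  refine linearMap_ext_zeta fun y => ?_
  have hd := g.2
  rw [Matrix.det_fin_two] at hd
  have h2 := two_unit (p := p) hp (2 * k)
  have hpk := pk_pk (p := p) (k := k)
  rw [LinearMap.comp_apply, acts_weil hp g y, map_smul, LinearMap.smul_apply, coeff_zeta,
    coeff_zeta, smul_eq_mul, smul_eq_mul]
  simp only [Matrix.mulVec, dotProduct, Fin.sum_univ_two]
  set a := g.1 0 0
  set b := g.1 0 1
  set c := g.1 1 0
  set d := g.1 1 1
  set q := (p : ZMod (p ^ (2 * k))) ^ k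
  have e : (q * (a * x 0 + b * x 1 - (a * y 0 + b * y 1)) = 0 ∧
      q * (c * x 0 + d * x 1 - (c * y 0 + d * y 1)) = 0) ↔
      (q * (x 0 - y 0) = 0 ∧ q * (x 1 - y 1) = 0) := by
    constructor
    · rintro ⟨h0, h1⟩
      exact ⟨by linear_combination d * h0 - b * h1 - q * (x 0 - y 0) * hd,
        by linear_combination a * h1 - c * h0 - q * (x 1 - y 1) * hd⟩
    · rintro ⟨h0, h1⟩
      exact ⟨by linear_combination a * h0 + b * h1, by linear_combination c * h0 + d * h1⟩
  simp only [e]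
  split_ifs with h
  · obtain ⟨u, hu⟩ := pk_mul_eq_zero h.1
    obtain ⟨v, hv⟩ := pk_mul_eq_zero h.2
    have hx0 : x 0 = y 0 + q * u := by linear_combination hu
    have hx1 : x 1 = y 1 + q * v := by linear_combination hv
    rw [← AddChar.map_add_eq_mul, ← AddChar.map_add_eq_mul, hx0, hx1]
    congr 1
    linear_combination 2⁻¹ * q * (y 0 * v - y 1 * u) * hd
      + 2⁻¹ * (u * v - (a * u + b * v) * (c * u + d * v)) * hpk
      - ((a * y 0 + b * y 1) * q * (c * u + d * v) - y 0 * q * v) * h2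
  · simp

end Coeff

/-! ### Hecke symmetry: support and constant modulus of the coefficients -/

section Hecke

variable {p k : ℕ} [Fact p.Prime]

lemma pow_k_mul_eq_zero_iff (w : ZMod (p ^ (2 * k))) :
    (p : ZMod (p ^ (2 * k))) ^ k * w = 0 ↔ (w.cast : ZMod (p ^ k)) = 0 := by
  rw [← pow_mul_eq_zero_iff (by omega), show 2 * k - k = k by omega]

lemma pow_k_mul_sub_eq_zero_iff (v w : ZMod (p ^ (2 * k))) :
    (p : ZMod (p ^ (2 * k))) ^ k * (v - w) = 0 ↔ (v.cast : ZMod (p ^ k)) = w.cast := by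
  rw [pow_k_mul_eq_zero_iff, ZMod.cast_sub (pow_dvd_pow p (by omega)), sub_eq_zero]

/-- The expansion of a state at a point. -/
lemma apply_eq_sum_coeff (ψ : State (p ^ (2 * k))) (y : ZMod (p ^ (2 * k))) :
    ψ y = ∑ a : ZMod (p ^ k), coeff ![(a.cast : ZMod (p ^ (2 * k))), y] ψ := by
  suffices (LinearMap.proj y : State (p ^ (2 * k)) →ₗ[ℂ] ℂ) =
      ∑ a : ZMod (p ^ k), coeff ![(a.cast : ZMod (p ^ (2 * k))), y] by
    have h := LinearMap.congr_fun this ψ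
    rwa [LinearMap.sum_apply] at h
  refine linearMap_ext_zeta fun x => ?_
  rw [LinearMap.sum_apply, LinearMap.proj_apply, zeta_apply]
  simp_rw [coeff_zeta, Matrix.cons_val_zero, Matrix.cons_val_one, pow_k_mul_sub_eq_zero_iff,
    cast_cast_of_le (show k ≤ 2 * k by omega), ite_and]
  simp

/-- Parseval's identity for the coefficients. -/
lemma sum_norm_sq_coeff (ψ : State (p ^ (2 * k))) :
    ∑ b, ∑ a, ‖coeff ![a, b] ψ‖ ^ 2 =
      (p : ℝ) ^ (3 * k) * normSq ψ := by
  have hp0 : (p : ℝ) ≠ 0 := by exact_mod_cast (Fact.out : p.Prime).ne_zero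
  have h : ∀ b : ZMod (p ^ (2 * k)), ∑ a : ZMod (p ^ (2 * k)), ‖∑ t : ZMod (p ^ k),
      ψ (b + (p : ZMod (p ^ (2 * k))) ^ k * t.cast) *
        (ZMod.stdAddChar (-(a * ((p : ZMod (p ^ (2 * k))) ^ k * t.cast))) : ℂ)‖ ^ 2 =
      ((p ^ (2 * k) : ℕ) : ℝ) *
        ∑ t : ZMod (p ^ k), ‖ψ (b + (p : ZMod (p ^ (2 * k))) ^ k * t.cast)‖ ^ 2 := fun b =>
    sum_norm_sq_char pow_mul_cast_injective _
  have h0 : ∀ a b : ZMod (p ^ (2 * k)), ‖coeff ![a, b] ψ‖ ^ 2 =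
      (((p : ℝ) ^ k)⁻¹) ^ 2 * ‖∑ t : ZMod (p ^ k),
        ψ (b + (p : ZMod (p ^ (2 * k))) ^ k * t.cast) *
          (ZMod.stdAddChar (-(a * ((p : ZMod (p ^ (2 * k))) ^ k * t.cast))) : ℂ)‖ ^ 2 := by
    intro a b
    rw [coeff_apply, norm_mul, mul_pow, norm_inv, norm_pow, Complex.norm_natCast]
    rfl
  simp_rw [h0, ← Finset.mul_sum, h, ← Finset.mul_sum]
  rw [Finset.sum_comm]
  -- Every value of `ψ` is counted once for each of the `p^k` translations; together with `N =
  -- p^(2k)` from `normSq` this gives `p^(3k)`.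
  have h' : ∀ t : ZMod (p ^ k), ∑ b : ZMod (p ^ (2 * k)),
      ‖ψ (b + (p : ZMod (p ^ (2 * k))) ^ k * t.cast)‖ ^ 2 =
      ∑ b : ZMod (p ^ (2 * k)), ‖ψ b‖ ^ 2 := fun t =>
    Fintype.sum_equiv (Equiv.addRight _) _ _ fun b => rfl
  simp_rw [h', Finset.sum_const, Finset.card_univ, ZMod.card, normSq, nsmul_eq_mul]
  push_cast
  field_simp
  ring

/-- The elements of `V_C` have their coefficients supported on `x₁² - D x₂² = -C`. -/
lemma coeff_eq_zero_of_mem_V {D : ZMod (p ^ (2 * k))} {C : ZMod (p ^ k)}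
    {ψ : State (p ^ (2 * k))} (hV : ψ ∈ V p k D C) {x : Fin 2 → ZMod (p ^ (2 * k))}
    (hx : ((x 0 ^ 2 - D * x 1 ^ 2).cast : ZMod (p ^ k)) ≠ -C) : coeff x ψ = 0 := by
  suffices V p k D C ≤ LinearMap.ker (coeff x) from this hV
  rw [V, Submodule.span_le]
  rintro _ ⟨y, hy, rfl⟩
  rw [SetLike.mem_coe, LinearMap.mem_ker, coeff_zeta, if_neg]
  rintro ⟨h0, h1⟩
  apply hx
  rw [← hy, ← pow_k_mul_sub_eq_zero_iff]
  linear_combination (x 0 + y 0) * h0 - D * (x 1 + y 1) * h1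

/-- The Hecke group acts transitively on the solutions of `x₁² - D x₂² = -C` modulo `p ^ k`. -/
lemma exists_heckeGroup_smul (hp : p ≠ 2) {D : ZMod (p ^ (2 * k))} {C : ZMod (p ^ k)}
    (hC : ¬ p ∣ C.val) {x y : Fin 2 → ZMod (p ^ (2 * k))}
    (hx : ((x 0 ^ 2 - D * x 1 ^ 2).cast : ZMod (p ^ k)) = -C)
    (hy : ((y 0 ^ 2 - D * y 1 ^ 2).cast : ZMod (p ^ k)) = -C) :
    ∃ h ∈ heckeGroup D,
      (p : ZMod (p ^ (2 * k))) ^ k * ((h.1 *ᵥ x) 0 - y 0) = 0 ∧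
      (p : ZMod (p ^ (2 * k))) ^ k * ((h.1 *ᵥ x) 1 - y 1) = 0 := by
  have hpk := pk_pk (p := p) (k := k)
  have h2 := two_unit (p := p) hp (2 * k)
  obtain ⟨v, hv⟩ : ∃ v : ZMod (p ^ (2 * k)), v * (C.val : ZMod (p ^ (2 * k))) = 1 :=
    ⟨_, natCast_inv_mul hC⟩
  have hcast : ∀ w : ZMod (p ^ (2 * k)), (w.cast : ZMod (p ^ k)) = -C →
      ∃ u : ℕ, w = -(C.val : ZMod (p ^ (2 * k))) + (p : ZMod (p ^ (2 * k))) ^ k * u := by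
    intro w hw
    have : (p : ZMod (p ^ (2 * k))) ^ k * (w + (C.val : ZMod (p ^ (2 * k)))) = 0 := by
      rw [pow_k_mul_eq_zero_iff, cast_add_of_le (by omega), hw,
        ZMod.cast_natCast (pow_dvd_pow p (by omega)), ZMod.natCast_zmod_val, neg_add_cancel]
    obtain ⟨u, hu⟩ := pk_mul_eq_zero this
    exact ⟨u, by linear_combination hu⟩
  obtain ⟨d, hd⟩ := hcast _ hx
  obtain ⟨e, he⟩ := hcast _ hy
  set c := (C.val : ZMod (p ^ (2 * k)))
  set q := (p : ZMod (p ^ (2 * k))) ^ k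
  set r := (2 : ZMod (p ^ (2 * k)))⁻¹
  -- the quotient `y / x` in `ℤ[√D]`, rescaled to norm one
  let m := -v * (1 + r * (q * v * (d + e)))
  -- The norms of `x` and `y` agree only modulo `p^k`, so dividing by the norm of `x` is not enough.
  -- As `q² = 0`, the inverse of the product of the norms is `v² (1 + q v (d + e))`, with square
  -- roots `± v (1 + r q v (d + e))`. The sign in `m` makes it the inverse of the norm of `x` modulo
  -- `p^k`.
  have hm : m ^ 2 * (x 0 ^ 2 - D * x 1 ^ 2) * (y 0 ^ 2 - D * y 1 ^ 2) = 1 := by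
    rw [hd, he]
    have e1 : m ^ 2 * (-c + q * d) * (-c + q * e) =
        (1 + r * (q * v * (d + e))) ^ 2 * (-1 + q * v * d) * (-1 + q * v * e) := by
      linear_combination (1 + r * (q * v * (d + e))) ^ 2 *
        (v * c + 1 - q * v * d - q * v * e) * hv
    rw [e1]
    set w := v * (d + e) with hw
    linear_combination (v ^ 2 * d * e - 2 * r * w ^ 2 + r ^ 2 * w ^ 2 +
      q * (2 * r * w * v ^ 2 * d * e - r ^ 2 * w ^ 3) + q ^ 2 * r ^ 2 * w ^ 2 * v ^ 2 * d * e) * hpk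
      + q * w * h2
  let a := (y 0 * x 0 - D * y 1 * x 1) * m
  let b := (y 1 * x 0 - y 0 * x 1) * m
  refine ⟨⟨!![a, b * D; b, a], ?_⟩, ⟨a, b, rfl⟩, ?_, ?_⟩
  · rw [Matrix.det_fin_two_of]
    linear_combination hm
  · have : a * x 0 + b * D * x 1 = y 0 * m * (x 0 ^ 2 - D * x 1 ^ 2) := by ring
    simp only [Matrix.mulVec, dotProduct, Fin.sum_univ_two, Matrix.of_apply, Matrix.cons_val_zero,
      Matrix.cons_val_one, this, hd]
    linear_combination q * y 0 * (1 + r * (q * v * (d + e))) * hv +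
      y 0 * (r * v * (d + e) - (1 + r * (q * v * (d + e))) * v * d) * hpk
  · have : b * x 0 + a * x 1 = y 1 * m * (x 0 ^ 2 - D * x 1 ^ 2) := by ring
    simp only [Matrix.mulVec, dotProduct, Fin.sum_univ_two, Matrix.of_apply, Matrix.cons_val_zero,
      Matrix.cons_val_one, this, hd]
    linear_combination q * y 1 * (1 + r * (q * v * (d + e))) * hv +
      y 1 * (r * v * (d + e) - (1 + r * (q * v * (d + e))) * v * d) * hpk

lemma weil_one (hp : p ≠ 2) :
    weil (1 : SpecialLinearGroup (Fin 2) (ZMod (p ^ (2 * k)))) = 1 := by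
  refine (acts_weil hp _).unique fun x => ?_
  simp

lemma weil_pow (hp : p ≠ 2) (g : SpecialLinearGroup (Fin 2) (ZMod (p ^ (2 * k)))) (n : ℕ) :
    weil (g ^ n) = weil g ^ n := by
  induction n with
  | zero => rw [pow_zero, pow_zero, weil_one hp]
  | succ n ih => rw [pow_succ, weil_mul hp, ih, pow_succ]

lemma pow_apply_of_eigen {M : Type*} [AddCommGroup M] [Module ℂ M] {T : M →ₗ[ℂ] M} {v : M} {c : ℂ}
    (h : T v = c • v) (n : ℕ) : (T ^ n) v = c ^ n • v := by
  induction n with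
  | zero => simp
  | succ n ih => rw [pow_succ, Module.End.mul_apply, h, map_smul, ih, smul_smul, pow_succ']

lemma ne_zero_of_normSq {N : ℕ} [NeZero N] {ψ : State N} (h : normSq ψ = 1) : ψ ≠ 0 := by
  rintro rfl
  simp [normSq] at h

/-- The eigenvalues of the quantization have modulus one. -/
lemma norm_eigenvalue_weil (hp : p ≠ 2) {g : SpecialLinearGroup (Fin 2) (ZMod (p ^ (2 * k)))}
    {ψ : State (p ^ (2 * k))} (hψ : ψ ≠ 0) {c : ℂ} (h : weil g ψ = c • ψ) : ‖c‖ = 1 := by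
  -- `SL(2, ℤ/N)` is finite, so the eigenvalue is a root of unity; unitarity of `U_N` is not needed.
  have h1 := pow_apply_of_eigen h (Fintype.card (SpecialLinearGroup (Fin 2) (ZMod (p ^ (2 * k)))))
  rw [← weil_pow hp, pow_card_eq_one, weil_one hp, Module.End.one_apply] at h1
  have h2 : c ^ Fintype.card (SpecialLinearGroup (Fin 2) (ZMod (p ^ (2 * k)))) = 1 :=
    smul_left_injective ℂ hψ (by simpa using h1.symm)
  exact Complex.norm_eq_one_of_pow_eq_one h2 Fintype.card_ne_zero

/-- The coefficients of a Hecke eigenfunction have constant modulus on `x₁² - D x₂² = -C`. -/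
lemma norm_coeff_eq (hp : p ≠ 2) {D : ZMod (p ^ (2 * k))} {C : ZMod (p ^ k)}
    (hC : ¬ p ∣ C.val) {ψ : State (p ^ (2 * k))} (hψ : IsNormalizedHeckeEigenfunction D ψ)
    {x y : Fin 2 → ZMod (p ^ (2 * k))}
    (hx : ((x 0 ^ 2 - D * x 1 ^ 2).cast : ZMod (p ^ k)) = -C)
    (hy : ((y 0 ^ 2 - D * y 1 ^ 2).cast : ZMod (p ^ k)) = -C) :
    ‖coeff x ψ‖ = ‖coeff y ψ‖ := by
  obtain ⟨h, hh, h0, h1⟩ := exists_heckeGroup_smul hp hC hx hy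
  obtain ⟨c, hc⟩ := hψ.2 h hh
  have e := congrArg norm (coeff_weil hp h x ψ)
  rwa [hc, map_smul, norm_smul, norm_eigenvalue_weil hp (ne_zero_of_normSq hψ.1) hc, one_mul,
    norm_mul, norm_stdAddChar, one_mul, coeff_congr h0 h1, norm_mul, norm_stdAddChar, one_mul,
    eq_comm] at e

end Hecke

/-! ### Points of the conic modulo a prime power -/

section Count

lemma card_castHom_fiber {d N : ℕ} [NeZero N] (h : d ∣ N) (a : ZMod d) :
    d * (Finset.univ.filter fun y : ZMod N => ZMod.castHom h (ZMod d) y = a).card = N := by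
  classical
  have : NeZero d := ⟨fun h0 => NeZero.ne N (by rwa [h0, zero_dvd_iff] at h)⟩
  have hs := ZMod.castHom_surjective h
  have h1 := Finset.card_eq_sum_card_fiberwise (s := Finset.univ) (t := Finset.univ)
    (f := ZMod.castHom h (ZMod d)) fun _ _ => Finset.mem_coe.2 (Finset.mem_univ _)
  have h2 : ∀ b ∈ (Finset.univ : Finset (ZMod d)),
      (Finset.univ.filter fun y : ZMod N => ZMod.castHom h (ZMod d) y = b).card =
      (Finset.univ.filter fun y : ZMod N => ZMod.castHom h (ZMod d) y = a).card := fun b _ =>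
    AddMonoidHom.card_fiber_eq_of_mem_range (ZMod.castHom h (ZMod d)) (hs b) (hs a)
  rw [Finset.sum_congr rfl h2, Finset.sum_const, Finset.card_univ, Finset.card_univ, ZMod.card,
    ZMod.card, smul_eq_mul] at h1
  exact h1.symm

lemma sum_comp_castHom {d N : ℕ} [NeZero N] [NeZero d] (h : d ∣ N) (f : ZMod d → ℝ) :
    d * ∑ y : ZMod N, f (ZMod.castHom h (ZMod d) y) = N * ∑ a, f a := by
  classical
  rw [← Finset.sum_fiberwise (s := Finset.univ) (g := ZMod.castHom h (ZMod d)), Finset.mul_sum,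
    Finset.mul_sum]
  refine Finset.sum_congr rfl fun a _ => ?_
  rw [Finset.sum_congr rfl (g := fun _ => f a)
    fun y hy => by rw [(Finset.mem_filter.1 hy).2], Finset.sum_const, nsmul_eq_mul,
    ← mul_assoc]
  congr 1
  exact_mod_cast card_castHom_fiber h a

/-- The number of points of the conic `x² - D y² = c` over a finite prime field. -/
lemma card_conic_field {p : ℕ} [Fact p.Prime] (hp : p ≠ 2) {D c : ZMod p} (hD : D ≠ 0)
    (hc : c ≠ 0) :
    ((Finset.univ.filter fun z : ZMod p × ZMod p => z.1 ^ 2 - D * z.2 ^ 2 = c).card : ℤ) =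
      p - quadraticChar (ZMod p) D := by
  classical
  set χ := quadraticChar (ZMod p)
  have hF : ringChar (ZMod p) ≠ 2 := by rwa [ZMod.ringChar_zmod_n]
  have hsq : ∀ a : ZMod p, ((Finset.univ.filter fun x : ZMod p => x ^ 2 = a).card : ℤ) =
      χ a + 1 := by
    intro a
    rw [← quadraticChar_card_sqrts hF a]
    congr 2
    ext x
    simp
  have hχ0 : ∑ u : ZMod p, χ u = 0 := quadraticChar_sum_zero hF
  have hχ2 : ∀ a : ZMod p, a ≠ 0 → χ a * χ a = 1 := fun a ha => by
    rw [← sq]; exact quadraticChar_sq_one ha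
  -- A quadratic character is its own inverse, so this is the Jacobi sum of `χ` and `χ⁻¹`.
  have hJ : ∑ u : ZMod p, χ u * χ (1 - u) = -χ (-1) := by
    rw [← jacobiSum_nontrivial_inv (quadraticChar_ne_one hF)]
    rw [(quadraticChar_isQuadratic (ZMod p)).inv]
    rfl
  have hK : ∑ u : ZMod p, χ u * χ (u - c) = -1 := by
    rw [← Fintype.sum_equiv (Equiv.mulLeft₀ c hc) (fun u => χ (c * u) * χ (c * u - c)) _
      fun u => rfl]
    have : ∀ u, χ (c * u) * χ (c * u - c) = χ (-1) * (χ u * χ (1 - u)) := by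
      intro u
      rw [show c * u - c = c * (-1 * (1 - u)) by ring, map_mul, map_mul, map_mul]
      linear_combination χ u * χ (-1) * χ (1 - u) * hχ2 c hc
    simp_rw [this, ← Finset.mul_sum, hJ]
    linear_combination -hχ2 (-1) (neg_ne_zero.2 one_ne_zero)
  -- For fixed `x`, multiplying the equation by `D` turns it into `(D y)² = D (x² - c)`, and a
  -- square root count is `χ + 1`.
  have h1 : ((Finset.univ.filter fun z : ZMod p × ZMod p => z.1 ^ 2 - D * z.2 ^ 2 = c).card : ℤ) =
      ∑ x : ZMod p, (χ D * χ (x ^ 2 - c) + 1) := by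
    rw [Finset.card_filter, Fintype.sum_prod_type]
    push_cast
    refine Finset.sum_congr rfl fun x _ => ?_
    rw [← map_mul, ← hsq, Finset.card_filter]
    push_cast
    refine Fintype.sum_equiv (Equiv.mulLeft₀ D hD) _ _ fun y => ?_
    have : x ^ 2 - D * y ^ 2 = c ↔ (D * y) ^ 2 = D * (x ^ 2 - c) := by
      rw [← sub_eq_zero, ← sub_eq_zero (a := (D * y) ^ 2),
        show (D * y) ^ 2 - D * (x ^ 2 - c) = -D * (x ^ 2 - D * y ^ 2 - c) by ring, mul_eq_zero,
        or_iff_right (neg_ne_zero.2 hD)]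
    simp [this]
  have h2 : ∑ x : ZMod p, χ (x ^ 2 - c) = -1 := by
    rw [← Finset.sum_fiberwise (s := Finset.univ) (g := fun x : ZMod p => x ^ 2)]
    have : ∀ u ∈ (Finset.univ : Finset (ZMod p)),
        ∑ x ∈ Finset.univ.filter (fun x : ZMod p => x ^ 2 = u), χ (x ^ 2 - c) =
        χ u * χ (u - c) + χ (u - c) := by
      intro u _
      rw [Finset.sum_congr rfl (g := fun _ => χ (u - c))
        fun y hy => by rw [(Finset.mem_filter.1 hy).2], Finset.sum_const, nsmul_eq_mul, hsq]
      ring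
    rw [Finset.sum_congr rfl this, Finset.sum_add_distrib, hK,
      Fintype.sum_equiv (Equiv.subRight c) (fun u => χ (u - c)) χ fun u => rfl, hχ0, add_zero]
  rw [h1, Finset.sum_add_distrib, ← Finset.mul_sum, h2]
  simp [ZMod.card]
  ring

variable {p n : ℕ} [Fact p.Prime]

lemma isUnit_iff_castHom_ne_zero (hn : n ≠ 0) (a : ZMod (p ^ n)) :
    IsUnit a ↔ ZMod.castHom (dvd_pow_self p hn) (ZMod p) a ≠ 0 := by
  constructor
  · intro h
    exact (h.map (ZMod.castHom (dvd_pow_self p hn) (ZMod p))).ne_zero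
  · intro h
    apply isUnit_of_not_dvd_val
    rwa [← ZMod.natCast_eq_zero_iff, ZMod.natCast_val]

/-- The uniqueness half of Hensel's lemma: `y + z` reduces to `2 y ≠ 0`, hence is a unit, and `(y +
z)(y - z) = 0`. -/
lemma eq_of_sq_eq_sq (hp : p ≠ 2) (hn : n ≠ 0) {y z : ZMod (p ^ n)}
    (hy : ZMod.castHom (dvd_pow_self p hn) (ZMod p) y ≠ 0)
    (hyz : ZMod.castHom (dvd_pow_self p hn) (ZMod p) y =
      ZMod.castHom (dvd_pow_self p hn) (ZMod p) z) (h : y ^ 2 = z ^ 2) : y = z := by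
  have h2 : (2 : ZMod p) ≠ 0 := by
    have : ringChar (ZMod p) ≠ 2 := by rwa [ZMod.ringChar_zmod_n]
    exact Ring.two_ne_zero this
  have hu : IsUnit (y + z) := by
    rw [isUnit_iff_castHom_ne_zero hn, map_add, ← hyz, ← two_mul]
    exact mul_ne_zero h2 hy
  rw [← sub_eq_zero, ← hu.mul_right_eq_zero]
  linear_combination h

/-- Lifting of square roots of units. -/
lemma exists_sq_eq (hp : p ≠ 2) (hn : n ≠ 0) {w : ZMod (p ^ n)} {x : ZMod p} (hx : x ≠ 0)
    (h : x ^ 2 = ZMod.castHom (dvd_pow_self p hn) (ZMod p) w) :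
    ∃ y : ZMod (p ^ n), y ^ 2 = w ∧ ZMod.castHom (dvd_pow_self p hn) (ZMod p) y = x := by
  classical
  set π := ZMod.castHom (dvd_pow_self p hn) (ZMod p)
  -- Existence by counting: squaring is injective from the fibre over `x` to the fibre over `x²`,
  -- and all fibres of reduction have the same size, so it is onto.
  have hcard : (Finset.univ.filter fun y => π y = π w).card ≤
      (Finset.univ.filter fun y => π y = x).card := by
    have h1 := card_castHom_fiber (dvd_pow_self p hn) (π w)
    exact (Nat.eq_of_mul_eq_mul_left (Fact.out : p.Prime).pos
      (h1.trans (card_castHom_fiber (dvd_pow_self p hn) x).symm)).le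
  have hmaps : ∀ y ∈ Finset.univ.filter fun y => π y = x,
      y ^ 2 ∈ Finset.univ.filter fun y => π y = π w := by
    intro y hy
    simp only [Finset.mem_filter, Finset.mem_univ, true_and] at hy ⊢
    rw [map_pow, hy, h]
  have hinj : Set.InjOn (fun y : ZMod (p ^ n) => y ^ 2)
      (Finset.univ.filter fun y => π y = x : Finset (ZMod (p ^ n))) := by
    intro y hy z hz hyz
    simp only [Finset.coe_filter, Finset.mem_univ, true_and, Set.mem_ofPred_eq] at hy hz
    exact eq_of_sq_eq_sq hp hn (by rwa [hy]) (hy.trans hz.symm) hyz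
  obtain ⟨y, hy, hyw⟩ := Finset.surjOn_of_injOn_of_card_le _ hmaps hinj hcard
    (show w ∈ _ by simp)
  exact ⟨y, hyw, by simpa using hy⟩

/-- The conic is smooth: `c ≠ 0` forces one coordinate to be nonzero modulo `p`. The other
coordinate lifts freely, and then the nonzero one lifts uniquely as a square root. -/
lemma card_conic_fiber (hp : p ≠ 2) (hn : n ≠ 0) {D c : ZMod (p ^ n)} (hD : IsUnit D)
    (hc : IsUnit c) {x y : ZMod p}
    (hxy : x ^ 2 - ZMod.castHom (dvd_pow_self p hn) (ZMod p) D * y ^ 2 =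
      ZMod.castHom (dvd_pow_self p hn) (ZMod p) c) :
    p * (Finset.univ.filter fun z : ZMod (p ^ n) × ZMod (p ^ n) =>
      z.1 ^ 2 - D * z.2 ^ 2 = c ∧ ZMod.castHom (dvd_pow_self p hn) (ZMod p) z.1 = x ∧
        ZMod.castHom (dvd_pow_self p hn) (ZMod p) z.2 = y).card = p ^ n := by
  classical
  set π := ZMod.castHom (dvd_pow_self p hn) (ZMod p)
  have hc' := (isUnit_iff_castHom_ne_zero hn c).1 hc
  by_cases hx : x = 0
  · have hy : y ≠ 0 := by
      rintro rfl
      apply hc'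
      rw [← hxy, hx]
      ring
    obtain ⟨E, hE⟩ := hD.exists_right_inv
    have hE' : π D * π E = 1 := by rw [← map_mul, hE, map_one]
    refine Eq.trans ?_ (card_castHom_fiber (dvd_pow_self p hn) x)
    congr 1
    refine Finset.card_bij (fun z _ => z.1) ?_ ?_ ?_
    · intro z hz
      simp only [Finset.mem_filter, Finset.mem_univ, true_and] at hz ⊢
      exact hz.2.1
    · rintro ⟨z, u⟩ hz ⟨z', u'⟩ hz' h
      simp only [Finset.mem_filter, Finset.mem_univ, true_and] at hz hz' h
      subst h
      congr 1
      refine eq_of_sq_eq_sq hp hn (by rw [hz.2.2]; exact hy) (hz.2.2.trans hz'.2.2.symm) ?_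
      linear_combination (-u ^ 2 + u' ^ 2) * hE + E * (hz'.1 - hz.1)
    · intro z hz
      simp only [Finset.mem_filter, Finset.mem_univ, true_and] at hz
      obtain ⟨u, hu, hu'⟩ := exists_sq_eq hp hn (w := E * (z ^ 2 - c)) hy (by
        change y ^ 2 = π (E * (z ^ 2 - c))
        rw [map_mul, map_sub, map_pow, show π z = x from hz]
        linear_combination -(y ^ 2) * hE' - π E * hxy)
      refine ⟨(z, u), ?_, rfl⟩
      simp only [Finset.mem_filter, Finset.mem_univ, true_and]
      exact ⟨by linear_combination -D * hu - (z ^ 2 - c) * hE, hz, hu'⟩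
  · refine Eq.trans ?_ (card_castHom_fiber (dvd_pow_self p hn) y)
    congr 1
    refine Finset.card_bij (fun z _ => z.2) ?_ ?_ ?_
    · intro z hz
      simp only [Finset.mem_filter, Finset.mem_univ, true_and] at hz ⊢
      exact hz.2.2
    · rintro ⟨z, u⟩ hz ⟨z', u'⟩ hz' h
      simp only [Finset.mem_filter, Finset.mem_univ, true_and] at hz hz' h
      subst h
      congr 1
      refine eq_of_sq_eq_sq hp hn (by rw [hz.2.1]; exact hx) (hz.2.1.trans hz'.2.1.symm) ?_
      linear_combination hz.1 - hz'.1
    · intro u hu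
      simp only [Finset.mem_filter, Finset.mem_univ, true_and] at hu
      obtain ⟨z, hz, hz'⟩ := exists_sq_eq hp hn (w := c + D * u ^ 2) hx (by
        change x ^ 2 = π (c + D * u ^ 2)
        rw [map_add, map_mul, map_pow, show π u = y from hu]
        linear_combination hxy)
      refine ⟨(z, u), ?_, rfl⟩
      simp only [Finset.mem_filter, Finset.mem_univ, true_and]
      exact ⟨by linear_combination hz, hz', hu⟩

/-- The number of points of the conic `x² - D y² = c` modulo a prime power. -/
lemma card_conic (hp : p ≠ 2) (hn : n ≠ 0) {D c : ZMod (p ^ n)} (hD : IsUnit D)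
    (hc : IsUnit c) :
    (p : ℤ) * (Finset.univ.filter fun z : ZMod (p ^ n) × ZMod (p ^ n) =>
      z.1 ^ 2 - D * z.2 ^ 2 = c).card =
      p ^ n * (p - quadraticChar (ZMod p) (ZMod.castHom (dvd_pow_self p hn) (ZMod p) D)) := by
  classical
  set π := ZMod.castHom (dvd_pow_self p hn) (ZMod p)
  rw [← card_conic_field hp ((isUnit_iff_castHom_ne_zero hn D).1 hD)
    ((isUnit_iff_castHom_ne_zero hn c).1 hc)]
  have h := Finset.card_eq_sum_card_fiberwise
    (s := Finset.univ.filter fun z : ZMod (p ^ n) × ZMod (p ^ n) => z.1 ^ 2 - D * z.2 ^ 2 = c)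
    (t := Finset.univ.filter fun z : ZMod p × ZMod p => z.1 ^ 2 - π D * z.2 ^ 2 = π c)
    (f := fun z => (π z.1, π z.2)) (by
      intro z hz
      simp only [Finset.coe_filter, Finset.mem_univ, true_and, Set.mem_ofPred_eq] at hz ⊢
      rw [← hz]
      simp)
  rw [h]
  push_cast
  rw [Finset.mul_sum, Finset.sum_congr rfl (g := fun _ => (p : ℤ) ^ n), Finset.sum_const,
    nsmul_eq_mul, mul_comm]
  rintro ⟨x, y⟩ hz
  simp only [Finset.mem_filter, Finset.mem_univ, true_and] at hz
  have := card_conic_fiber hp hn hD hc hz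
  rw [Finset.filter_filter]
  simp only [Prod.mk.injEq]
  exact_mod_cast this

end Count

/-! ### The common modulus of the coefficients -/

section Modulus

variable {p k : ℕ} [Fact p.Prime]

/-- The modulus of the coefficients of a Hecke eigenfunction in `V_C`. -/
lemma norm_coeff (hp : p ≠ 2) (hk : k ≠ 0) {D : ZMod (p ^ (2 * k))} {C : ZMod (p ^ k)}
    (hC : ¬ p ∣ C.val) (hD : ¬ p ∣ D.val) {ψ : State (p ^ (2 * k))}
    (hψ : IsNormalizedHeckeEigenfunction D ψ) (hV : ψ ∈ V p k D C)
    {x : Fin 2 → ZMod (p ^ (2 * k))}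
    (hx : ((x 0 ^ 2 - D * x 1 ^ 2).cast : ZMod (p ^ k)) = -C) :
    ‖coeff x ψ‖ = 1 / Real.sqrt (1 - (legendreSym p (D.val : ℤ) : ℝ) * (1 / (p : ℝ))) := by
  classical
  have hdvd : p ^ k ∣ p ^ (2 * k) := pow_dvd_pow p (by omega)
  have hp0 : (p : ℝ) ≠ 0 := by exact_mod_cast (Fact.out : p.Prime).ne_zero
  set π := ZMod.castHom hdvd (ZMod (p ^ k)) with hπ
  have h1 := sum_norm_sq_coeff ψ
  rw [hψ.1, mul_one] at h1
  have h2 : ∀ a b : ZMod (p ^ (2 * k)), ‖coeff ![a, b] ψ‖ ^ 2 =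
      (if π a ^ 2 - π D * π b ^ 2 = -C then 1 else 0) * ‖coeff x ψ‖ ^ 2 := by
    intro a b
    have e : ((![a, b] 0 ^ 2 - D * ![a, b] 1 ^ 2).cast : ZMod (p ^ k)) =
        π a ^ 2 - π D * π b ^ 2 := by
      rw [← ZMod.castHom_apply (h := hdvd), map_sub, map_mul, map_pow, map_pow]
      rfl
    split_ifs with h
    · rw [norm_coeff_eq hp hC hψ hx (e.trans h), one_mul]
    · rw [coeff_eq_zero_of_mem_V hV (by rwa [e])]
      simp
  simp_rw [h2, ← Finset.sum_mul] at h1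
  -- Passes from solutions with coordinates in `ℤ/p^(2k)` to solutions in `ℤ/p^k`, one coordinate at
  -- a time.
  have h3 : ((p ^ k : ℕ) : ℝ) * (((p ^ k : ℕ) : ℝ) * ∑ b : ZMod (p ^ (2 * k)),
      ∑ a : ZMod (p ^ (2 * k)), if π a ^ 2 - π D * π b ^ 2 = -C then (1 : ℝ) else 0) =
      ((p ^ (2 * k) : ℕ) : ℝ) * (((p ^ (2 * k) : ℕ) : ℝ) * ∑ b : ZMod (p ^ k),
        ∑ a : ZMod (p ^ k), if a ^ 2 - π D * b ^ 2 = -C then (1 : ℝ) else 0) := by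
    rw [← sum_comp_castHom hdvd (fun b => ∑ a : ZMod (p ^ k),
      if a ^ 2 - π D * b ^ 2 = -C then (1 : ℝ) else 0), mul_left_comm, ← mul_assoc,
      mul_comm _ ((p ^ k : ℕ) : ℝ), mul_left_comm _ ((p ^ k : ℕ) : ℝ), mul_assoc]
    congr 1
    rw [Finset.mul_sum, Finset.mul_sum]
    exact Finset.sum_congr rfl fun b _ => sum_comp_castHom hdvd
      (fun a => if a ^ 2 - π D * π b ^ 2 = -C then (1 : ℝ) else 0)
  have hDk : IsUnit (π D) := (isUnit_of_not_dvd_val hD).map _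
  have h4 := card_conic hp hk hDk (isUnit_of_not_dvd_val hC).neg
  have h5 : quadraticChar (ZMod p) (ZMod.castHom (dvd_pow_self p hk) (ZMod p) (π D)) =
      legendreSym p (D.val : ℤ) := by
    rw [legendreSym, hπ, ← ZMod.natCast_zmod_val D, map_natCast, map_natCast]
    simp
  rw [h5] at h4
  have h6 : ((Finset.univ.filter fun z : ZMod (p ^ k) × ZMod (p ^ k) =>
      z.1 ^ 2 - π D * z.2 ^ 2 = -C).card : ℝ) = ∑ b : ZMod (p ^ k),
        ∑ a : ZMod (p ^ k), if a ^ 2 - π D * b ^ 2 = -C then (1 : ℝ) else 0 := by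
    rw [Finset.card_filter, Fintype.sum_prod_type, Finset.sum_comm]
    push_cast
    rfl
  have h7 := congrArg (Int.cast : ℤ → ℝ) h4
  push_cast at h7 h3
  rw [h6] at h7
  set M := ∑ b : ZMod (p ^ (2 * k)), ∑ a : ZMod (p ^ (2 * k)),
    if π a ^ 2 - π D * π b ^ 2 = -C then (1 : ℝ) else 0
  set m := ∑ b : ZMod (p ^ k), ∑ a : ZMod (p ^ k),
    if a ^ 2 - π D * b ^ 2 = -C then (1 : ℝ) else 0
  set l : ℝ := (legendreSym p (D.val : ℤ) : ℝ)
  have h8 : (1 - l * (1 / (p : ℝ))) * ‖coeff x ψ‖ ^ 2 = 1 := by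
    have hq : (p : ℝ) ^ k ≠ 0 := pow_ne_zero _ hp0
    have e2 : (p : ℝ) ^ (2 * k) = (p : ℝ) ^ k * (p : ℝ) ^ k := by rw [two_mul, pow_add]
    have e3 : (p : ℝ) ^ (3 * k) = (p : ℝ) ^ k * (p : ℝ) ^ k * (p : ℝ) ^ k := by
      rw [← pow_add, ← pow_add]; congr 1; ring
    rw [e3] at h1
    rw [e2] at h3
    have hM : M = (p : ℝ) ^ k * (p : ℝ) ^ k * m := by
      apply mul_left_cancel₀ (mul_ne_zero hq hq)
      linear_combination h3
    have e4 : (p : ℝ) ^ k * (p : ℝ) ^ k * (p : ℝ) ^ k * p *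
        ((1 - l * (1 / (p : ℝ))) * ‖coeff x ψ‖ ^ 2) =
        (p : ℝ) ^ k * (p : ℝ) ^ k * (p : ℝ) ^ k * p * 1 := by
      have e5 : (p : ℝ) * (1 - l * (1 / (p : ℝ))) = p - l := by field_simp
      rw [hM] at h1
      linear_combination (p : ℝ) * h1 - (p : ℝ) ^ k * (p : ℝ) ^ k * ‖coeff x ψ‖ ^ 2 * h7
        + (p : ℝ) ^ k * (p : ℝ) ^ k * (p : ℝ) ^ k * ‖coeff x ψ‖ ^ 2 * e5
    exact mul_left_cancel₀ (mul_ne_zero (mul_ne_zero (mul_ne_zero hq hq) hq) hp0) e4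
  -- Positivity of the quantity under the root comes for free, since it is the inverse of a square.
  have h9 : 1 - l * (1 / (p : ℝ)) = (‖coeff x ψ‖ ^ 2)⁻¹ := eq_inv_of_mul_eq_one_left h8
  rw [h9, Real.sqrt_inv, Real.sqrt_sq (norm_nonneg _), one_div, inv_inv]

end Modulus

/-! ### Cubic exponential sums -/

section ExpSum

variable {p n : ℕ} [Fact p.Prime]

lemma isUnit_add_prime_mul {a : ZMod (p ^ n)} (ha : IsUnit a) (x : ZMod (p ^ n)) :
    IsUnit (a + p * x) := by
  rcases eq_or_ne n 0 with rfl | hn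
  · exact isUnit_pow_zero _
  · rw [isUnit_iff_castHom_ne_zero hn] at ha ⊢
    rwa [map_add, map_mul, map_natCast, ZMod.natCast_self, zero_mul, add_zero]

lemma exists_mem_Icc_natCast_eq {N : ℕ} [NeZero N] (w : ZMod N) :
    ∃ z ∈ Finset.Icc 1 N, (z : ZMod N) = w := by
  have hN := Nat.pos_of_ne_zero (NeZero.ne N)
  rcases Nat.eq_zero_or_pos w.val with h | h
  · exact ⟨N, Finset.mem_Icc.2 ⟨hN, le_rfl⟩, by
      rw [ZMod.natCast_self, (ZMod.val_eq_zero w).1 h]⟩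
  · exact ⟨w.val, Finset.mem_Icc.2 ⟨h, (ZMod.val_lt w).le⟩, by simp⟩

lemma natCast_injOn_Icc {N : ℕ} {y z : ℕ} (hy : y ∈ Finset.Icc 1 N) (hz : z ∈ Finset.Icc 1 N)
    (h : (y : ZMod N) = z) : y = z := by
  rw [Finset.mem_Icc] at hy hz
  rw [← Int.cast_natCast, ← Int.cast_natCast z, ← sub_eq_zero, ← Int.cast_sub,
    ZMod.intCast_zmod_eq_zero_iff_dvd] at h
  have := Int.eq_zero_of_abs_lt_dvd h (by rw [abs_lt]; omega)
  omega

lemma sum_Icc_natCast {N : ℕ} [NeZero N] (f : ZMod N → ℂ) :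
    ∑ z ∈ Finset.Icc 1 N, f (z : ZMod N) = ∑ z, f z :=
  Finset.sum_bij (fun z _ => (z : ZMod N)) (fun _ _ => Finset.mem_univ _)
    (fun _ hy _ hz h => natCast_injOn_Icc hy hz h)
    (fun w _ => by
      obtain ⟨z, hz, h⟩ := exists_mem_Icc_natCast_eq w
      exact ⟨z, hz, h⟩)
    fun _ _ => rfl

/-- A complete cubic sum modulo `p ^ n` whose cubic coefficient is divisible by `p`, and whose
quadratic coefficient is not, has modulus `p ^ (n / 2)`. -/
lemma norm_sq_cubic_sum {a b c : ZMod (p ^ n)} (hp : p ≠ 2) (hb : IsUnit b) :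
    ‖∑ z : ZMod (p ^ n),
      (ZMod.stdAddChar (a * z + b * z ^ 2 + (p : ZMod (p ^ n)) * c * z ^ 3) : ℂ)‖ ^ 2 =
      (p : ℝ) ^ n := by
  classical
  have h2 : IsUnit (2 : ZMod (p ^ n)) := by
    have := two_unit (p := p) hp n
    exact IsUnit.of_mul_eq_one_right _ this
  set f : ZMod (p ^ n) → ZMod (p ^ n) := fun z =>
    a * z + b * z ^ 2 + (p : ZMod (p ^ n)) * c * z ^ 3
  set g : ZMod (p ^ n) → ZMod (p ^ n) → ZMod (p ^ n) := fun h z =>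
    a + b * (2 * z + h) + (p : ZMod (p ^ n)) * c * (3 * z ^ 2 + 3 * z * h + h ^ 2)
  -- `g` is the difference quotient: `f (z + h) - f z = h * g h z`. In turn `g h y - g h z` is `y -
  -- z` times `2 b` plus a multiple of `p`, a unit. Hence the inner sums of the squared modulus are
  -- full character sums, and only `h = 0` survives.
  have hg : ∀ h, Function.Bijective (g h) := by
    intro h
    rw [← Finite.injective_iff_bijective]
    intro y z hyz
    have hu := isUnit_add_prime_mul (h2.mul hb) (c * (3 * (y + z) + 3 * h))
    rw [← sub_eq_zero, ← hu.mul_right_eq_zero]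
    simp only [g] at hyz
    linear_combination hyz
  have h : ((‖∑ z : ZMod (p ^ n), (ZMod.stdAddChar (f z) : ℂ)‖ ^ 2 : ℝ) : ℂ) =
      (((p : ℝ) ^ n : ℝ) : ℂ) := by
    push_cast
    rw [← Complex.conj_mul', map_sum, Finset.sum_mul_sum]
    have e1 : ∀ z : ZMod (p ^ n), ∑ y : ZMod (p ^ n),
        (starRingEnd ℂ) (ZMod.stdAddChar (f z) : ℂ) * ZMod.stdAddChar (f y) =
        ∑ h : ZMod (p ^ n), (ZMod.stdAddChar (h * g h z) : ℂ) := by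
      intro z
      refine (Fintype.sum_equiv (Equiv.addLeft z) _ _ fun h => ?_).symm
      rw [← AddChar.map_neg_eq_conj, ← AddChar.map_add_eq_mul, Equiv.coe_addLeft]
      congr 1
      simp only [f, g]
      ring
    simp_rw [e1]
    rw [Finset.sum_comm]
    have e2 : ∀ h : ZMod (p ^ n), ∑ z : ZMod (p ^ n), (ZMod.stdAddChar (h * g h z) : ℂ) =
        if h = 0 then (p : ℂ) ^ n else 0 := by
      intro h
      rw [Function.Bijective.sum_comp (hg h) fun y => (ZMod.stdAddChar (h * y) : ℂ)]
      simp_rw [mul_comm h]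
      rw [AddChar.sum_mulShift (R := ZMod (p ^ n)) (R' := ℂ) h
        (ZMod.isPrimitive_stdAddChar (p ^ n)), ZMod.card]
      push_cast
      rfl
    simp_rw [e2]
    simp
  exact_mod_cast h

end ExpSum

/-! ### The eigenvalue of `B(s)` and the number `C'` -/

section Eigenvalue

/-- The powers of the truncated exponential matrix of `q √D`. -/
lemma truncExp_pow {R : Type*} [CommRing R] {r t q : R} (hr : r * 2 = 1) (ht : t * 3 = 1)
    (hq : q ^ 4 = 0) (D : R) (z : ℕ) :
    !![1 + r * D * q ^ 2, q * D; q, 1 + r * D * q ^ 2] ^ z =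
      !![1 + r * D * z ^ 2 * q ^ 2, (z * q + r * t * (z ^ 3 - z) * D * q ^ 3) * D;
        z * q + r * t * (z ^ 3 - z) * D * q ^ 3, 1 + r * D * z ^ 2 * q ^ 2] := by
  -- With `u = q √D` and `u⁴ = 0`, the base is `1 + u + u²/2 = exp(u - u³/6)`, so the power is
  -- `exp(z u - z u³/6)`. This explains `z³ - z` with coefficient `r t = 1/6`; its part `-z`
  -- produces the correction `p^(2(k-s)) 3⁻¹ r D² b²` in `Θ`.
  induction z with
  | zero =>
    rw [pow_zero]
    ext i j
    fin_cases i <;> fin_cases j <;> simp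
  | succ z ih =>
    have e0 : (1 + r * D * z ^ 2 * q ^ 2) * (1 + r * D * q ^ 2) +
        (z * q + r * t * (z ^ 3 - z) * D * q ^ 3) * D * q =
        1 + r * D * (z + 1) ^ 2 * q ^ 2 := by
      linear_combination (r ^ 2 * D ^ 2 * z ^ 2 + r * t * (z ^ 3 - z) * D ^ 2) * hq -
        D * z * q ^ 2 * hr
    have e1 : (z * q + r * t * (z ^ 3 - z) * D * q ^ 3) * (1 + r * D * q ^ 2) +
        (1 + r * D * z ^ 2 * q ^ 2) * q =
        (z + 1) * q + r * t * ((z + 1) ^ 3 - (z + 1)) * D * q ^ 3 := by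
      linear_combination (r ^ 2 * t * (z ^ 3 - z) * D ^ 2 * q) * hq -
        r * (z ^ 2 + z) * D * q ^ 3 * ht
    rw [pow_succ, ih]
    push_cast
    ext i j
    fin_cases i <;> fin_cases j <;> simp only [Matrix.mul_apply, Fin.sum_univ_two] <;> simp
    · linear_combination e0
    · linear_combination D * e1
    · linear_combination e1
    · linear_combination e0

variable {p k : ℕ}

lemma prime_pow_eq_zero {m n : ℕ} (h : n ≤ m) : (p : ZMod (p ^ n)) ^ m = 0 := by
  rw [← Nat.cast_pow, ZMod.natCast_eq_zero_iff]
  exact pow_dvd_pow p h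

lemma val_pow (g : SpecialLinearGroup (Fin 2) (ZMod (p ^ (2 * k)))) (n : ℕ) :
    (g ^ n).1 = g.1 ^ n := Matrix.SpecialLinearGroup.coe_pow g n

variable [Fact p.Prime]

lemma exists_stdAddChar_eq {N : ℕ} [NeZero N] {c : ℂ} (h : c ^ N = 1) :
    ∃ j : ZMod N, (ZMod.stdAddChar j : ℂ) = c := by
  obtain ⟨i, -, hi⟩ := (Complex.isPrimitiveRoot_exp N (NeZero.ne N)).eq_pow_of_pow_eq_one h
  refine ⟨((i : ℤ) : ZMod N), ?_⟩
  rw [← hi, ZMod.stdAddChar_coe, ← Complex.exp_nat_mul]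
  congr 1
  push_cast
  ring

lemma exists_coeff_ne_zero {D : ZMod (p ^ (2 * k))} {C : ZMod (p ^ k)}
    {ψ : State (p ^ (2 * k))} (hψ : ψ ≠ 0) (hV : ψ ∈ V p k D C) :
    ∃ x : Fin 2 → ZMod (p ^ (2 * k)),
      ((x 0 ^ 2 - D * x 1 ^ 2).cast : ZMod (p ^ k)) = -C ∧ coeff x ψ ≠ 0 := by
  by_contra! h
  apply hψ
  have h0 : ∀ x, coeff x ψ = 0 := fun x => by
    by_cases hx : ((x 0 ^ 2 - D * x 1 ^ 2).cast : ZMod (p ^ k)) = -C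
    · exact h x hx
    · exact coeff_eq_zero_of_mem_V hV hx
  funext y
  simp [apply_eq_sum_coeff ψ y, h0]

lemma three_unit (hp : p ≠ 3) (n : ℕ) : (3 : ZMod (p ^ n))⁻¹ * 3 = 1 := by
  have := natCast_inv_mul (p := p) (n := n) (a := 3)
    (by rwa [Nat.prime_dvd_prime_iff_eq Fact.out Nat.prime_three])
  exact_mod_cast this

lemma cast_two_inv (hp : p ≠ 2) {m n : ℕ} (h : m ≤ n) :
    (((2 : ZMod (p ^ n))⁻¹).cast : ZMod (p ^ m)) = 2⁻¹ := by
  have := cast_natCast_inv (p := p) h (a := 2)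
    (by rwa [Nat.prime_dvd_prime_iff_eq Fact.out Nat.prime_two])
  exact_mod_cast this

lemma cast_three_inv (hp : p ≠ 3) {m n : ℕ} (h : m ≤ n) :
    (((3 : ZMod (p ^ n))⁻¹).cast : ZMod (p ^ m)) = 3⁻¹ := by
  have := cast_natCast_inv (p := p) h (a := 3)
    (by rwa [Nat.prime_dvd_prime_iff_eq Fact.out Nat.prime_three])
  exact_mod_cast this

lemma cast_trans {l m n : ℕ} (hlm : l ≤ m) (w : ZMod (p ^ n)) :
    ((w.cast : ZMod (p ^ m)).cast : ZMod (p ^ l)) = w.cast := by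
  rw [← ZMod.natCast_val w, ZMod.cast_natCast (pow_dvd_pow p hlm), ZMod.natCast_val]

/-- The Hecke eigenvalue of the matrix `(1, p^k D; p^k, 1)` on `V_C`. -/
lemma eigenvalue_eq (hp : p ≠ 2) {D : ZMod (p ^ (2 * k))} {C : ZMod (p ^ k)}
    {ψ : State (p ^ (2 * k))} (hψ : ψ ≠ 0) (hV : ψ ∈ V p k D C)
    {g : SpecialLinearGroup (Fin 2) (ZMod (p ^ (2 * k)))}
    (hg : g.1 = !![1, (p : ZMod (p ^ (2 * k))) ^ k * D; (p : ZMod (p ^ (2 * k))) ^ k, 1]) {c : ℂ}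
    (hc : weil g ψ = c • ψ) : c = ZMod.stdAddChar (2⁻¹ * C) := by
  obtain ⟨x, hx, hx0⟩ := exists_coeff_ne_zero hψ hV
  have hpk := pk_pk (p := p) (k := k)
  have h2 := two_unit (p := p) hp (2 * k)
  have h := coeff_weil hp g x ψ
  have e0 : (g.1 *ᵥ x) 0 = x 0 + (p : ZMod (p ^ (2 * k))) ^ k * D * x 1 := by
    rw [hg]; simp [Matrix.mulVec, dotProduct, Fin.sum_univ_two]
  have e1 : (g.1 *ᵥ x) 1 = (p : ZMod (p ^ (2 * k))) ^ k * x 0 + x 1 := by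
    rw [hg]; simp [Matrix.mulVec, dotProduct, Fin.sum_univ_two]
  -- `g` fixes `x` modulo `p^k`, so both sides involve the same nonzero coefficient and the
  -- eigenvalue can be read off from the phases.
  rw [hc, map_smul, coeff_congr (x' := x) (by rw [e0]; linear_combination D * x 1 * hpk)
    (by rw [e1]; linear_combination x 0 * hpk), smul_eq_mul, ← mul_assoc] at h
  have h' := mul_right_cancel₀ hx0 h
  have hC : C = ((-(x 0 ^ 2 - D * x 1 ^ 2)).cast : ZMod (p ^ k)) := by
    rw [ZMod.cast_neg (pow_dvd_pow p (by omega)), hx, neg_neg]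
  rw [hC, ← cast_two_inv hp (show k ≤ 2 * k by omega), ← cast_mul_of_le (by omega),
    stdAddChar_cast (by omega), show 2 * k - k = k by omega]
  have hne : (ZMod.stdAddChar ((g.1 *ᵥ x) 0 * ((g.1 *ᵥ x) 1 - x 1)) : ℂ) ≠ 0 := by
    rw [← norm_ne_zero_iff, norm_stdAddChar]; exact one_ne_zero
  apply mul_right_cancel₀ hne
  rw [h', ← AddChar.map_add_eq_mul, e0, e1]
  congr 1
  set q := (p : ZMod (p ^ (2 * k))) ^ k
  linear_combination (2⁻¹ * D * x 0 * x 1 - D * x 0 * x 1) * hpk + q * x 0 ^ 2 * h2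

/-- The eigenvalue of `B(s)` on `V_C`. -/
lemma exists_eigenvalue (hp : p ≠ 2) (hp3 : p ≠ 3) {D : ZMod (p ^ (2 * k))} {C : ZMod (p ^ k)}
    {ψ : State (p ^ (2 * k))} (hψ : ψ ≠ 0) (hV : ψ ∈ V p k D C) {s : ℕ} (hs : 2 * s < k)
    {g : SpecialLinearGroup (Fin 2) (ZMod (p ^ (2 * k)))}
    (hg : g.1 = !![1 + 2⁻¹ * D * (p : ZMod (p ^ (2 * k))) ^ (2 * (k - s)),
                  (p : ZMod (p ^ (2 * k))) ^ (k - s) * D;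
               (p : ZMod (p ^ (2 * k))) ^ (k - s),
                  1 + 2⁻¹ * D * (p : ZMod (p ^ (2 * k))) ^ (2 * (k - s))]) {c : ℂ}
    (hc : weil g ψ = c • ψ) :
    ∃ C' : ZMod (p ^ (k + s)), (C'.cast : ZMod (p ^ k)) = C ∧
      c = ZMod.stdAddChar (2⁻¹ * C') := by
  have hq4 : ((p : ZMod (p ^ (2 * k))) ^ (k - s)) ^ 4 = 0 := by
    rw [← pow_mul]; exact prime_pow_eq_zero (by omega)
  -- The power `z = p^s` turns `p^(k-s)` into `p^k`; the higher terms vanish modulo `p^(2k)`. So the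
  -- eigenvalue is a `p^s`-th root of `e(r C / p^k)`, which is what makes `C'` a lift of `C` to
  -- level `p^(k+s)`.
  have hpow : (g ^ p ^ s).1 =
      !![1, (p : ZMod (p ^ (2 * k))) ^ k * D; (p : ZMod (p ^ (2 * k))) ^ k, 1] := by
    rw [val_pow, hg, mul_comm 2 (k - s),
      pow_mul (p : ZMod (p ^ (2 * k))) (k - s) 2, truncExp_pow (two_unit hp _) (three_unit hp3 _) hq4]
    have e1 : ((p ^ s : ℕ) : ZMod (p ^ (2 * k))) * (p : ZMod (p ^ (2 * k))) ^ (k - s) =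
        (p : ZMod (p ^ (2 * k))) ^ k := by
      push_cast; rw [← pow_add]; congr 1; omega
    have e2 : ((p ^ s : ℕ) : ZMod (p ^ (2 * k))) * ((p : ZMod (p ^ (2 * k))) ^ (k - s)) ^ 3 =
        0 := by
      push_cast; rw [← pow_mul, ← pow_add]; exact prime_pow_eq_zero (by omega)
    have hpk := pk_pk (p := p) (k := k)
    set P := ((p ^ s : ℕ) : ZMod (p ^ (2 * k)))
    set q := (p : ZMod (p ^ (2 * k))) ^ (k - s)
    set r := (2 : ZMod (p ^ (2 * k)))⁻¹
    set t := (3 : ZMod (p ^ (2 * k)))⁻¹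
    have e3 : P * q + r * t * (P ^ 3 - P) * D * q ^ 3 = (p : ZMod (p ^ (2 * k))) ^ k := by
      linear_combination e1 + r * t * D * (P ^ 2 - 1) * e2
    have e4 : 1 + r * D * P ^ 2 * q ^ 2 = 1 := by
      rw [← e1] at hpk
      linear_combination r * D * hpk
    rw [e3, e4]
  have hcp : c ^ p ^ s = ZMod.stdAddChar (2⁻¹ * C) := by
    refine eigenvalue_eq hp hψ hV hpow ?_
    rw [weil_pow hp, pow_apply_of_eigen hc]
  have hc1 : c ^ p ^ (k + s) = 1 := by
    rw [add_comm, pow_add, pow_mul, hcp, ← AddChar.map_nsmul_eq_pow, nsmul_eq_mul,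
      ZMod.natCast_self, zero_mul, AddChar.map_zero_eq_one]
  obtain ⟨j, hj⟩ := exists_stdAddChar_eq hc1
  have h2 := two_unit (p := p) hp (k + s)
  refine ⟨2 * j, ?_, ?_⟩
  · have e : (j.cast : ZMod (p ^ k)) = 2⁻¹ * C := by
      apply ZMod.injective_stdAddChar
      rw [← hcp, ← hj, ← AddChar.map_nsmul_eq_pow, stdAddChar_cast (by omega), nsmul_eq_mul,
        show k + s - k = s by omega]
      push_cast
      rfl
    have e2 : ((2 : ZMod (p ^ (k + s))).cast : ZMod (p ^ k)) = 2 := by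
      exact_mod_cast ZMod.cast_natCast (pow_dvd_pow p (show k ≤ k + s by omega)) 2
    rw [cast_mul_of_le (by omega), e, e2]
    linear_combination C * two_unit (p := p) hp k
  · rw [← hj]
    congr 1
    linear_combination -j * h2

/-- Multiplication by `p^k` identifies `ℤ/p^s` with the multiples of `p^k` in `ℤ/p^(k+s)`. -/
lemma existsUnique_cast_mul_pow {s : ℕ} {w : ZMod (p ^ (k + s))}
    (hw : (w.cast : ZMod (p ^ k)) = 0) :
    ∃! Θ : ZMod (p ^ s), (Θ.cast : ZMod (p ^ (k + s))) * (p : ZMod (p ^ (k + s))) ^ k = w := by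
  have key : ∀ v : ZMod (p ^ (k + s)),
      (p : ZMod (p ^ (k + s))) ^ k * v = 0 ↔ (v.cast : ZMod (p ^ s)) = 0 := by
    intro v
    rw [← pow_mul_eq_zero_iff (by omega), show k + s - s = k by omega]
  obtain ⟨u, hu⟩ : ∃ u : ℕ, w = (p : ZMod (p ^ (k + s))) ^ k * (u : ZMod (p ^ (k + s))) := by
    rw [← ZMod.natCast_val, ZMod.natCast_eq_zero_iff] at hw
    obtain ⟨u, hu⟩ := hw
    refine ⟨u, ?_⟩
    rw [← ZMod.natCast_zmod_val w, hu]
    push_cast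
    rfl
  refine ⟨(u : ZMod (p ^ s)), ?_, fun Θ hΘ => ?_⟩
  · have := (key (((u : ZMod (p ^ s)).cast : ZMod (p ^ (k + s))) - u)).2 (by
      rw [ZMod.cast_sub (pow_dvd_pow p (by omega)), cast_cast_of_le (by omega),
        ZMod.cast_natCast (pow_dvd_pow p (by omega)), sub_self])
    simp only
    linear_combination this - hu
  · have := (key ((Θ.cast : ZMod (p ^ (k + s))) - u)).1 (by linear_combination hΘ + hu)
    rwa [ZMod.cast_sub (pow_dvd_pow p (by omega)), cast_cast_of_le (by omega),
      ZMod.cast_natCast (pow_dvd_pow p (by omega)), sub_eq_zero] at this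

end Eigenvalue

/-! ### The cubic phase along an orbit of `B(s)` -/

section Phase

/-- The phase bookkeeping for `coeff_orbit`, with `P = p^s`, `q = p^(k-s)`, `ρ = p^(k-2s)`. The left
side adds the eigenvalue of `B(s)^z`, the change of representative from `coeff_congr`, and the cubic
phase scaled by `P q² = p^(2k-s)`; the right side is the phase of the Weil action. The hypothesis on
`Θ` is its defining congruence modulo `p^(k+s)`, multiplied by `q`. -/
lemma phase_identity {R : Type*} [CommRing R] {r t q P ρ D b y C Θ z a β : R} (hr : r * 2 = 1)
    (ht : t * 3 = 1) (hq : q ^ 4 = 0) (hPq : P ^ 2 * q ^ 2 = 0) (hρ : P * ρ = q)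
    (hΘ : q * (Θ * (P * q) + y ^ 2 * P ^ 2 + C - D * b ^ 2 + q ^ 2 * t * r * D ^ 2 * b ^ 2) = 0)
    (ha : a = 1 + r * D * z ^ 2 * q ^ 2) (hβ : β = z * q + r * t * (z ^ 3 - z) * D * q ^ 3) :
    z * (q * (r * C)) + (a * (y * P) + β * D * b) * (β * (y * P) + a * b - b) +
      P * q ^ 2 * (r * (Θ * z - y * D * b * z ^ 2 - ρ * t * D ^ 2 * b ^ 2 * z ^ 3)) =
    r * ((a * (y * P) + β * D * b) * (β * (y * P) + a * b) - y * P * b) := by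
  subst ha hβ
  set B := r * t * (z ^ 3 - z) * D with hB
  linear_combination r * (z * hΘ + (y * P * b * (r ^ 2 * D ^ 2 * z ^ 4 + 2 * z * B * D +
      B ^ 2 * D * q ^ 2) + b ^ 2 * D * (r * D * z ^ 2 * B * q)) * hq +
      y ^ 2 * (B * q + r * D * z ^ 3 * q + r * D * z ^ 2 * B * q ^ 3) * hPq
      - b ^ 2 * D ^ 2 * q ^ 3 * z ^ 3 * (r * ht - t * hr)
      - q ^ 2 * t * D ^ 2 * b ^ 2 * z ^ 3 * hρ) -
    ((1 + r * D * z ^ 2 * q ^ 2) * (y * P) + (z * q + B * q ^ 3) * D * b) *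
      ((z * q + B * q ^ 3) * (y * P) + (1 + r * D * z ^ 2 * q ^ 2) * b - b) * hr

variable {p k : ℕ} [Fact p.Prime]

/-- The coefficients of a Hecke eigenfunction along the orbit of `B(s)`. -/
lemma coeff_orbit (hp : p ≠ 2) (hp3 : p ≠ 3) {D b : ZMod (p ^ (2 * k))}
    {ψ : State (p ^ (2 * k))} {s : ℕ} (hs : 2 * s < k)
    {g : SpecialLinearGroup (Fin 2) (ZMod (p ^ (2 * k)))}
    (hg : g.1 = !![1 + 2⁻¹ * D * (p : ZMod (p ^ (2 * k))) ^ (2 * (k - s)),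
                  (p : ZMod (p ^ (2 * k))) ^ (k - s) * D;
               (p : ZMod (p ^ (2 * k))) ^ (k - s),
                  1 + 2⁻¹ * D * (p : ZMod (p ^ (2 * k))) ^ (2 * (k - s))])
    {C' : ZMod (p ^ (k + s))}
    (hc : weil g ψ = (ZMod.stdAddChar (2⁻¹ * C') : ℂ) • ψ) {y : ZMod (p ^ (2 * k))}
    {Θ : ZMod (p ^ s)}
    (hΘ : (Θ.cast : ZMod (p ^ (k + s))) * (p : ZMod (p ^ (k + s))) ^ k =
      -(y.cast : ZMod (p ^ (k + s))) ^ 2 * (p : ZMod (p ^ (k + s))) ^ (2 * s) - C'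
        + D.cast * b.cast ^ 2
        - (p : ZMod (p ^ (k + s))) ^ (2 * (k - s)) * 3⁻¹ * 2⁻¹ * D.cast ^ 2 * b.cast ^ 2)
    (z : ℕ) :
    coeff ![y * (p : ZMod (p ^ (2 * k))) ^ s + (p : ZMod (p ^ (2 * k))) ^ (k - s) *
        ((z : ZMod (p ^ (2 * k))) * (D * b)),
        b] ψ =
      ZMod.stdAddChar (2⁻¹ * (Θ * (z : ZMod (p ^ s)) - y.cast * D.cast * b.cast * (z : ZMod (p ^ s)) ^ 2
        - (p : ZMod (p ^ s)) ^ (k - 2 * s) * 3⁻¹ * D.cast ^ 2 * b.cast ^ 2 *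
          (z : ZMod (p ^ s)) ^ 3)) *
        coeff ![y * (p : ZMod (p ^ (2 * k))) ^ s, b] ψ := by
  have hks : k + s ≤ 2 * k := by omega
  have hsk : s ≤ 2 * k := by omega
  have hr := two_unit (p := p) hp (2 * k)
  have ht := three_unit (p := p) hp3 (2 * k)
  have hq : ((p : ZMod (p ^ (2 * k))) ^ (k - s)) ^ 4 = 0 := by
    rw [← pow_mul]; exact prime_pow_eq_zero (by omega)
  have hPq : ((p : ZMod (p ^ (2 * k))) ^ s) ^ 2 * ((p : ZMod (p ^ (2 * k))) ^ (k - s)) ^ 2 = 0 := by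
    rw [← pow_mul, ← pow_mul, ← pow_add]; exact prime_pow_eq_zero (by omega)
  have hρ : (p : ZMod (p ^ (2 * k))) ^ s * (p : ZMod (p ^ (2 * k))) ^ (k - 2 * s) =
      (p : ZMod (p ^ (2 * k))) ^ (k - s) := by
    rw [← pow_add]; congr 1; omega
  have hPk : (p : ZMod (p ^ (2 * k))) ^ k =
      (p : ZMod (p ^ (2 * k))) ^ s * (p : ZMod (p ^ (2 * k))) ^ (k - s) := by
    rw [← pow_add]; congr 1; omega
  have hPqq : (p : ZMod (p ^ (2 * k))) ^ (2 * k - s) =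
      (p : ZMod (p ^ (2 * k))) ^ s * ((p : ZMod (p ^ (2 * k))) ^ (k - s)) ^ 2 := by
    rw [← pow_mul, ← pow_add]; congr 1; omega
  have hq2 : (p : ZMod (p ^ (2 * k))) ^ (2 * (k - s)) =
      ((p : ZMod (p ^ (2 * k))) ^ (k - s)) ^ 2 := by
    rw [← pow_mul, mul_comm 2 (k - s)]
  have hgz := val_pow g z
  rw [hg, hq2, truncExp_pow hr ht hq] at hgz
  have hΘ' : (p : ZMod (p ^ (2 * k))) ^ (k - s) * ((Θ.cast : ZMod (p ^ (2 * k))) *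
      ((p : ZMod (p ^ (2 * k))) ^ s * (p : ZMod (p ^ (2 * k))) ^ (k - s)) +
      y ^ 2 * ((p : ZMod (p ^ (2 * k))) ^ s) ^ 2 + C'.cast - D * b ^ 2 +
      ((p : ZMod (p ^ (2 * k))) ^ (k - s)) ^ 2 * 3⁻¹ * 2⁻¹ * D ^ 2 * b ^ 2) = 0 := by
    rw [show k - s = 2 * k - (k + s) by omega, pow_mul_eq_zero_iff hks,
      show 2 * k - (k + s) = k - s by omega, ← hPk, ← hq2]
    have h2 := cast_two_inv hp hks
    have h3 := cast_three_inv hp3 hks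
    have h4 : (((C'.cast : ZMod (p ^ (2 * k)))).cast : ZMod (p ^ (k + s))) = C' :=
      cast_cast_of_le hks C'
    have h5 : (((Θ.cast : ZMod (p ^ (2 * k)))).cast : ZMod (p ^ (k + s))) = Θ.cast :=
      cast_trans hks Θ
    rw [← ZMod.castHom_apply (h := pow_dvd_pow p hks)] at h2 h3 h4 h5 ⊢
    simp only [← ZMod.castHom_apply (h := pow_dvd_pow p hks) (R := ZMod (p ^ (k + s))) (D)]
      at hΘ
    simp only [← ZMod.castHom_apply (h := pow_dvd_pow p hks) (R := ZMod (p ^ (k + s))) (b)]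
      at hΘ
    simp only [← ZMod.castHom_apply (h := pow_dvd_pow p hks) (R := ZMod (p ^ (k + s))) (y)]
      at hΘ
    simp only [map_add, map_sub, map_mul, map_pow, map_natCast, h2, h3, h4, h5]
    rw [hΘ]
    ring
  have key := phase_identity hr ht hq hPq hρ hΘ' (a := _) (β := _) (z := (z : ZMod (p ^ (2 * k))))
    rfl rfl
  have hlam : (ZMod.stdAddChar (2⁻¹ * C') : ℂ) ^ z =
      ZMod.stdAddChar ((z : ZMod (p ^ (2 * k))) * ((p : ZMod (p ^ (2 * k))) ^ (k - s) *
        (2⁻¹ * (C'.cast : ZMod (p ^ (2 * k)))))) := by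
    rw [← nsmul_eq_mul z, AddChar.map_nsmul_eq_pow, show k - s = 2 * k - (k + s) by omega,
      ← stdAddChar_cast hks, cast_mul_of_le hks, cast_two_inv hp hks, cast_cast_of_le hks]
  have hph : (ZMod.stdAddChar (2⁻¹ * (Θ * (z : ZMod (p ^ s)) - y.cast * D.cast * b.cast * (z : ZMod (p ^ s)) ^ 2
        - (p : ZMod (p ^ s)) ^ (k - 2 * s) * 3⁻¹ * D.cast ^ 2 * b.cast ^ 2 *
          (z : ZMod (p ^ s)) ^ 3)) : ℂ) =
      ZMod.stdAddChar ((p : ZMod (p ^ (2 * k))) ^ s * ((p : ZMod (p ^ (2 * k))) ^ (k - s)) ^ 2 *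
        (2⁻¹ * ((Θ.cast : ZMod (p ^ (2 * k))) * (z : ZMod (p ^ (2 * k))) - y * D * b * (z : ZMod (p ^ (2 * k))) ^ 2
          - (p : ZMod (p ^ (2 * k))) ^ (k - 2 * s) * 3⁻¹ * D ^ 2 * b ^ 2 *
            (z : ZMod (p ^ (2 * k))) ^ 3))) := by
    rw [← hPqq, ← stdAddChar_cast hsk]
    congr 1
    have h2 := cast_two_inv hp hsk
    have h3 := cast_three_inv hp3 hsk
    have h5 : (((Θ.cast : ZMod (p ^ (2 * k)))).cast : ZMod (p ^ s)) = Θ :=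
      cast_cast_of_le hsk Θ
    rw [← ZMod.castHom_apply (h := pow_dvd_pow p hsk)] at h2 h3 h5
    rw [← ZMod.castHom_apply (h := pow_dvd_pow p hsk) (_ * _)]
    simp only [map_sub, map_mul, map_pow, map_natCast, h2, h3, h5]
    simp only [ZMod.castHom_apply]
  set q := (p : ZMod (p ^ (2 * k))) ^ (k - s)
  set P := (p : ZMod (p ^ (2 * k))) ^ s
  set r := (2 : ZMod (p ^ (2 * k)))⁻¹
  set t := (3 : ZMod (p ^ (2 * k)))⁻¹
  set ρ := (p : ZMod (p ^ (2 * k))) ^ (k - 2 * s)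
  set x : Fin 2 → ZMod (p ^ (2 * k)) := ![y * P, b] with hx
  have e0 : ((g ^ z).1 *ᵥ x) 0 = (1 + r * D * z ^ 2 * q ^ 2) * (y * P) +
      (z * q + r * t * (z ^ 3 - z) * D * q ^ 3) * D * b := by
    rw [hgz]; simp [Matrix.mulVec, dotProduct, Fin.sum_univ_two, hx]
  have e1 : ((g ^ z).1 *ᵥ x) 1 = (z * q + r * t * (z ^ 3 - z) * D * q ^ 3) * (y * P) +
      (1 + r * D * z ^ 2 * q ^ 2) * b := by
    rw [hgz]; simp [Matrix.mulVec, dotProduct, Fin.sum_univ_two, hx]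
  have h := coeff_weil hp (g ^ z) x ψ
  -- Modulo `p^k` the image of `(y p^s, b)` is `(y p^s + p^(k-s) z D b, b)`: the remaining terms
  -- contain `P q = p^k`, or `q²`, which is a multiple of `p^k` since `2 s < k`.
  rw [weil_pow hp, pow_apply_of_eigen hc, map_smul, smul_eq_mul,
    coeff_congr (x' := ![y * P + q * ((z : ZMod (p ^ (2 * k))) * (D * b)), b]) ?_ ?_, hlam, ← mul_assoc, e0, e1] at h
  · rw [hph]
    have hne : ∀ w : ZMod (p ^ (2 * k)), (ZMod.stdAddChar w : ℂ) ≠ 0 := fun w => by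
      rw [← norm_ne_zero_iff, norm_stdAddChar]; exact one_ne_zero
    have key' := congrArg (ZMod.stdAddChar : ZMod (p ^ (2 * k)) → ℂ) key
    rw [AddChar.map_add_eq_mul, AddChar.map_add_eq_mul] at key'
    rw [show x 0 = y * P from rfl, show x 1 = b from rfl, ← key'] at h
    exact mul_left_cancel₀ (mul_ne_zero (hne _) (hne _)) (h.trans (mul_assoc _ _ _))
  · rw [hPk, e0]
    simp only [Matrix.cons_val_zero]
    linear_combination r * D * z ^ 2 * y * q * hPq +
      r * t * (z ^ 3 - z) * D * D * b * P * hq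
  · rw [hPk, e1]
    simp only [Matrix.cons_val_one, Matrix.cons_val_zero]
    linear_combination (y * (z + r * t * (z ^ 3 - z) * D * q ^ 2) + ρ * r * D * z ^ 2 * b) * hPq -
      P * q ^ 2 * r * D * z ^ 2 * b * hρ

end Phase

/-! ### Splitting the roots into two orbits -/

section Final

variable {p k : ℕ} [Fact p.Prime]

lemma isUnit_intCast {n : ℕ} {a : ℤ} (ha : ¬ (p : ℤ) ∣ a) : IsUnit (a : ZMod (p ^ n)) := by
  rw [ZMod.coe_int_isUnit_iff_isCoprime, Nat.cast_pow]
  exact (((Nat.prime_iff_prime_int.1 (Fact.out : p.Prime)).irreducible.coprime_iff_not_dvd).2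
    ha).pow_left

/-- The solutions `± x₀ p^s + p^(k-s) m` are parametrized by `± x₀ p^s + p^(k-s) z w`,
`1 ≤ z ≤ p^s`, when `w` is a unit modulo `p^s`. -/
lemma sum_solutions (hp : p ≠ 2) {s : ℕ} (hs : 2 * s < k) {x₀ : ℤ} (hx₀ : ¬ (p : ℤ) ∣ x₀)
    {w : ZMod (p ^ k)} (hw : IsUnit (w.cast : ZMod (p ^ s))) {F : ZMod (p ^ k) → ℂ}
    (hF : ∀ a, F a ≠ 0 → ∃ m : ZMod (p ^ k),
        a = (x₀ : ZMod (p ^ k)) * (p : ZMod (p ^ k)) ^ s + (p : ZMod (p ^ k)) ^ (k - s) * m ∨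
        a = -((x₀ : ZMod (p ^ k)) * (p : ZMod (p ^ k)) ^ s) + (p : ZMod (p ^ k)) ^ (k - s) * m) :
    ∑ a, F a =
      ∑ z ∈ Finset.Icc 1 (p ^ s), F ((x₀ : ZMod (p ^ k)) * (p : ZMod (p ^ k)) ^ s +
        (p : ZMod (p ^ k)) ^ (k - s) * ((z : ZMod (p ^ k)) * w)) +
      ∑ z ∈ Finset.Icc 1 (p ^ s), F (-((x₀ : ZMod (p ^ k)) * (p : ZMod (p ^ k)) ^ s) +
        (p : ZMod (p ^ k)) ^ (k - s) * ((z : ZMod (p ^ k)) * w)) := by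
  classical
  have hsk : s ≤ k := by omega
  have hdvd := pow_dvd_pow p hsk
  have hinj : ∀ c : ZMod (p ^ k), Set.InjOn (fun z : ℕ => c +
      (p : ZMod (p ^ k)) ^ (k - s) * ((z : ZMod (p ^ k)) * w)) (Finset.Icc 1 (p ^ s)) := by
    intro c y hy z hz h
    apply natCast_injOn_Icc hy hz
    have h1 : (p : ZMod (p ^ k)) ^ (k - s) * ((y - z : ZMod (p ^ k)) * w) = 0 := by
      simp only at h
      linear_combination h
    rw [pow_mul_eq_zero_iff hsk, cast_mul_of_le hsk, hw.mul_left_eq_zero, ZMod.cast_sub hdvd,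
      ZMod.cast_natCast hdvd, ZMod.cast_natCast hdvd, sub_eq_zero] at h1
    exact h1
  rw [← Finset.sum_image (f := F) (hinj ((x₀ : ZMod (p ^ k)) * (p : ZMod (p ^ k)) ^ s)),
    ← Finset.sum_image (f := F) (hinj (-((x₀ : ZMod (p ^ k)) * (p : ZMod (p ^ k)) ^ s))),
    ← Finset.sum_union]
  · symm
    apply Finset.sum_subset (Finset.subset_univ _)
    intro a _ ha
    by_contra hFa
    apply ha
    obtain ⟨m, hm⟩ := hF a hFa
    obtain ⟨v, hv⟩ := hw.exists_right_inv
    -- Only `m` modulo `p^s` matters, and there `z = m w⁻¹` solves `z w = m`.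
    obtain ⟨z, hz, hzm⟩ := exists_mem_Icc_natCast_eq ((m.cast : ZMod (p ^ s)) * v)
    have h1 : (p : ZMod (p ^ k)) ^ (k - s) * ((z : ZMod (p ^ k)) * w - m) = 0 := by
      rw [pow_mul_eq_zero_iff hsk, ZMod.cast_sub hdvd, cast_mul_of_le hsk,
        ZMod.cast_natCast hdvd, hzm]
      linear_combination (m.cast : ZMod (p ^ s)) * hv
    rw [Finset.mem_union, Finset.mem_image, Finset.mem_image]
    rcases hm with hm | hm
    · exact Or.inl ⟨z, hz, by rw [hm]; linear_combination h1⟩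
    · exact Or.inr ⟨z, hz, by rw [hm]; linear_combination h1⟩
  · rw [Finset.disjoint_left]
    intro a ha ha'
    obtain ⟨y, -, hy⟩ := Finset.mem_image.1 ha
    obtain ⟨z, -, hz⟩ := Finset.mem_image.1 ha'
    -- A common element would give `p^s (2 x₀ + p ⋯) = 0` modulo `p^k`; the bracket is a unit, while
    -- `p^s ≠ 0` because `s < k`.
    have hu : IsUnit (2 * (x₀ : ZMod (p ^ k))) := by
      exact IsUnit.mul (IsUnit.of_mul_eq_one_right _ (two_unit (p := p) hp k))
        (isUnit_intCast hx₀)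
    have hu' := isUnit_add_prime_mul hu
      ((p : ZMod (p ^ k)) ^ (k - 2 * s - 1) * (((y : ZMod (p ^ k)) - z) * w))
    have e : (p : ZMod (p ^ k)) ^ (k - s) =
        (p : ZMod (p ^ k)) ^ s * (p * (p : ZMod (p ^ k)) ^ (k - 2 * s - 1)) := by
      rw [← pow_succ', ← pow_add]; congr 1; omega
    have h0 : (p : ZMod (p ^ k)) ^ s = 0 := by
      rw [← hu'.mul_left_eq_zero]
      rw [← hy, e] at hz
      linear_combination -hz
    rw [← Nat.cast_pow, ZMod.natCast_eq_zero_iff,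
      Nat.pow_dvd_pow_iff_le_right (Fact.out : p.Prime).one_lt] at h0
    omega

/-- For `s ≥ 1` the equation reads `w b² ≡ C` modulo `p`, and `p` does not divide `C`; for `s = 0`
the target ring is trivial. -/
lemma isUnit_cast_of_sq_eq {s : ℕ} (hs : s < k) {x w C : ZMod (p ^ k)} {b : ZMod (p ^ (2 * k))}
    (hC : ¬ p ∣ C.val) (h : (x * (p : ZMod (p ^ k)) ^ s) ^ 2 = -C + w * b.cast ^ 2) :
    IsUnit (b.cast : ZMod (p ^ s)) := by
  rcases Nat.eq_zero_or_pos s with rfl | hs0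
  · exact isUnit_pow_zero _
  · have hu := isUnit_add_prime_mul (isUnit_of_not_dvd_val hC)
      (p * (x * (p : ZMod (p ^ k)) ^ (s - 1)) ^ 2)
    have e : (p : ZMod (p ^ k)) ^ s = p * (p : ZMod (p ^ k)) ^ (s - 1) := by
      rw [← pow_succ']; congr 1; omega
    rw [e] at h
    rw [show C + p * (p * (x * (p : ZMod (p ^ k)) ^ (s - 1)) ^ 2) = w * b.cast * b.cast by
      linear_combination h] at hu
    have := isUnit_cast (m := s) hs.le (isUnit_of_mul_isUnit_right hu)
    rwa [cast_trans hs.le] at this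

lemma norm_cubic_sum_Icc (hp : p ≠ 2) {s j : ℕ} (hj : j ≠ 0) (Θ : ZMod (p ^ s))
    {B : ZMod (p ^ s)} (hB : IsUnit B) (E : ZMod (p ^ s)) {f : ZMod (p ^ s) → ZMod (p ^ s)}
    (hf : ∀ z, f z = 2⁻¹ * (Θ * z + B * z ^ 2 + (p : ZMod (p ^ s)) ^ j * E * z ^ 3)) :
    ‖expSum p s f‖ = Real.sqrt ((p : ℝ) ^ s) := by
  have h2 : IsUnit ((2 : ZMod (p ^ s))⁻¹) := IsUnit.of_mul_eq_one _ (two_unit (p := p) hp s)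
  have e : ∀ z, f z = 2⁻¹ * Θ * z + 2⁻¹ * B * z ^ 2 +
      (p : ZMod (p ^ s)) * (2⁻¹ * (p : ZMod (p ^ s)) ^ (j - 1) * E) * z ^ 3 := by
    intro z
    have : (p : ZMod (p ^ s)) ^ j = p * (p : ZMod (p ^ s)) ^ (j - 1) := by
      rw [← pow_succ']; congr 1; omega
    rw [hf, this]
    ring
  rw [eq_comm, Real.sqrt_eq_iff_mul_self_eq (by positivity) (norm_nonneg _), ← sq, expSum,
    sum_Icc_natCast fun z => (ZMod.stdAddChar (f z) : ℂ)]
  simp_rw [e]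
  exact (norm_sq_cubic_sum hp (h2.mul hB)).symm

/-- Converts equality of moduli into a unimodular factor. The degenerate case `A S = 0` is included
so that `A` need only be nonnegative. -/
lemma exists_unit_mul {u S : ℂ} {A : ℝ} (hA : 0 ≤ A) (h : ‖u‖ = A * ‖S‖) :
    ∃ α : ℂ, ‖α‖ = 1 ∧ u = A * (α * S) := by
  by_cases h0 : (A : ℂ) * S = 0
  · refine ⟨1, norm_one, ?_⟩
    have : ‖u‖ = 0 := by
      rcases mul_eq_zero.1 h0 with h' | h'
      · rw [h, Complex.ofReal_eq_zero.1 h', zero_mul]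
      · rw [h, h', norm_zero, mul_zero]
    rw [one_mul, h0, norm_eq_zero.1 this]
  · refine ⟨u / (A * S), ?_, ?_⟩
    · rw [norm_div, norm_mul, Complex.norm_real, Real.norm_of_nonneg hA, ← h, div_self]
      rw [h]
      intro h'
      apply h0
      rw [← norm_eq_zero, norm_mul, Complex.norm_real, Real.norm_of_nonneg hA, h']
    · have h1 : (A : ℂ) ≠ 0 := left_ne_zero_of_mul h0
      have h2 : S ≠ 0 := right_ne_zero_of_mul h0
      field_simp

/-- The contribution of one sign to the value of a Hecke eigenfunction. -/
lemma norm_sum_orbit (hp : p ≠ 2) (hp3 : p ≠ 3) {D b : ZMod (p ^ (2 * k))}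
    {ψ : State (p ^ (2 * k))} {s : ℕ} (hs : 2 * s < k)
    {g : SpecialLinearGroup (Fin 2) (ZMod (p ^ (2 * k)))}
    (hg : g.1 = !![1 + 2⁻¹ * D * (p : ZMod (p ^ (2 * k))) ^ (2 * (k - s)),
                  (p : ZMod (p ^ (2 * k))) ^ (k - s) * D;
               (p : ZMod (p ^ (2 * k))) ^ (k - s),
                  1 + 2⁻¹ * D * (p : ZMod (p ^ (2 * k))) ^ (2 * (k - s))])
    {C' : ZMod (p ^ (k + s))}
    (hc : weil g ψ = (ZMod.stdAddChar (2⁻¹ * C') : ℂ) • ψ) {y : ZMod (p ^ (2 * k))}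
    {Θ : ZMod (p ^ s)}
    (hΘ : (Θ.cast : ZMod (p ^ (k + s))) * (p : ZMod (p ^ (k + s))) ^ k =
      -(y.cast : ZMod (p ^ (k + s))) ^ 2 * (p : ZMod (p ^ (k + s))) ^ (2 * s) - C'
        + D.cast * b.cast ^ 2
        - (p : ZMod (p ^ (k + s))) ^ (2 * (k - s)) * 3⁻¹ * 2⁻¹ * D.cast ^ 2 * b.cast ^ 2)
    (hu : IsUnit ((y.cast : ZMod (p ^ s)) * D.cast * b.cast)) :
    ‖∑ z ∈ Finset.Icc 1 (p ^ s),
      coeff ![(((y * (p : ZMod (p ^ (2 * k))) ^ s + (p : ZMod (p ^ (2 * k))) ^ (k - s) *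
        ((z : ZMod (p ^ (2 * k))) * (D * b))).cast : ZMod (p ^ k)).cast : ZMod (p ^ (2 * k))),
        b] ψ‖ =
      ‖coeff ![y * (p : ZMod (p ^ (2 * k))) ^ s, b] ψ‖ * Real.sqrt ((p : ℝ) ^ s) := by
  -- Replacing the first coordinate by the canonical lift of its class costs no phase, because the
  -- second coordinate is unchanged.
  have h : ∀ z : ℕ, coeff ![(((y * (p : ZMod (p ^ (2 * k))) ^ s +
      (p : ZMod (p ^ (2 * k))) ^ (k - s) *
        ((z : ZMod (p ^ (2 * k))) * (D * b))).cast : ZMod (p ^ k)).cast : ZMod (p ^ (2 * k))),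
        b] ψ = coeff ![y * (p : ZMod (p ^ (2 * k))) ^ s + (p : ZMod (p ^ (2 * k))) ^ (k - s) *
        ((z : ZMod (p ^ (2 * k))) * (D * b)), b] ψ := by
    intro z
    rw [coeff_congr (x' := ![y * (p : ZMod (p ^ (2 * k))) ^ s +
      (p : ZMod (p ^ (2 * k))) ^ (k - s) * ((z : ZMod (p ^ (2 * k))) * (D * b)), b])]
    · simp
    · simp only [Matrix.cons_val_zero]
      rw [pow_k_mul_sub_eq_zero_iff, cast_cast_of_le (by omega)]
    · simp
  simp_rw [h, coeff_orbit hp hp3 hs hg hc hΘ]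
  rw [← Finset.sum_mul, norm_mul, mul_comm]
  congr 1
  exact norm_cubic_sum_Icc hp (show k - 2 * s ≠ 0 by omega) Θ hu.neg
    (-(3⁻¹ * (D.cast : ZMod (p ^ s)) ^ 2 * (b.cast : ZMod (p ^ s)) ^ 2))
    (f := fun z => 2⁻¹ * (Θ * z - y.cast * D.cast * b.cast * z ^ 2
        - (p : ZMod (p ^ s)) ^ (k - 2 * s) * 3⁻¹ * D.cast ^ 2 * b.cast ^ 2 * z ^ 3))
    fun z => by ring

end Final

end CatMap

/-! ### Assembly of the theorem -/

theorem mainTheorem9 (p k : ℕ) [Fact p.Prime] (hp : 3 < p)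
    (D : ZMod (p ^ (2 * k))) (C : ZMod (p ^ k))
    (hC : ¬ p ∣ C.val) (hD : ¬ p ∣ D.val)
    (ψ : CatMap.State (p ^ (2 * k)))
    (hψ : CatMap.IsNormalizedHeckeEigenfunction D ψ) (hV : ψ ∈ CatMap.V p k D C)
    (b : ZMod (p ^ (2 * k))) (x₀ : ℤ) (s : ℕ) (hx₀ : ¬ (p : ℤ) ∣ x₀) (hs : 2 * s < k)
    (hsol : ∀ x : ZMod (p ^ k), x ^ 2 = -C + D.cast * b.cast ^ 2 ↔
      ∃ m : ZMod (p ^ k),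
        x = (x₀ : ZMod (p ^ k)) * (p : ZMod (p ^ k)) ^ s + (p : ZMod (p ^ k)) ^ (k - s) * m ∨
        x = -((x₀ : ZMod (p ^ k)) * (p : ZMod (p ^ k)) ^ s) + (p : ZMod (p ^ k)) ^ (k - s) * m) :
    (∃! Θ : ZMod (p ^ s), CatMap.IsTheta p k s D C ψ b x₀ Θ) ∧
    ∀ Θ : ZMod (p ^ s), CatMap.IsTheta p k s D C ψ b x₀ Θ →
      ∃ α β : ℂ, ‖α‖ = 1 ∧ ‖β‖ = 1 ∧
        ψ b = ((1 / Real.sqrt (1 - (legendreSym p (D.val : ℤ) : ℝ) * (1 / (p : ℝ))) : ℝ) : ℂ) *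
          (α * CatMap.expSum p s (CatMap.cubic p k s D b x₀ Θ 1)
            + β * CatMap.expSum p s (CatMap.cubic p k s D b x₀ Θ (-1))) := by
  have hp2 : p ≠ 2 := by omega
  have hp3 : p ≠ 3 := by omega
  have hk : k ≠ 0 := by omega
  have hks : k + s ≤ 2 * k := by omega
  have hk2 : k ≤ 2 * k := by omega
  have hsk : s ≤ 2 * k := by omega
  have hψ0 := CatMap.ne_zero_of_normSq hψ.1
  have hsq : ((x₀ : ZMod (p ^ k)) * (p : ZMod (p ^ k)) ^ s) ^ 2 = -C + D.cast * b.cast ^ 2 :=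
    (hsol _).2 ⟨0, Or.inl (by ring)⟩
  have hq4 : ((p : ZMod (p ^ (2 * k))) ^ (2 * (k - s))) ^ 2 = 0 := by
    rw [← pow_mul]; exact CatMap.prime_pow_eq_zero (by omega)
  have hr := CatMap.two_unit (p := p) hp2 (2 * k)
  let g : Matrix.SpecialLinearGroup (Fin 2) (ZMod (p ^ (2 * k))) :=
    ⟨!![1 + 2⁻¹ * D * (p : ZMod (p ^ (2 * k))) ^ (2 * (k - s)),
        (p : ZMod (p ^ (2 * k))) ^ (k - s) * D;
      (p : ZMod (p ^ (2 * k))) ^ (k - s),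
        1 + 2⁻¹ * D * (p : ZMod (p ^ (2 * k))) ^ (2 * (k - s))], by
      rw [Matrix.det_fin_two_of]
      rw [mul_comm 2 (k - s), pow_mul (p : ZMod (p ^ (2 * k))) (k - s) 2] at hq4 ⊢
      linear_combination 2⁻¹ ^ 2 * D ^ 2 * hq4 +
        D * ((p : ZMod (p ^ (2 * k))) ^ (k - s)) ^ 2 * hr⟩
  have hg : g ∈ CatMap.heckeGroup D := ⟨_, _, rfl⟩
  obtain ⟨c, hc⟩ := hψ.2 g hg
  obtain ⟨C', hC', hcC'⟩ := CatMap.exists_eigenvalue hp2 hp3 hψ0 hV hs rfl hc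
  rw [hcC'] at hc
  constructor
  -- Modulo `p^k` the right side of the congruence for `Θ` reduces to `-x₀² p^(2s) - C + D b²`,
  -- which vanishes because `x₀ p^s` is one of the roots.
  · have hw : ((-(x₀ : ZMod (p ^ (k + s))) ^ 2 * (p : ZMod (p ^ (k + s))) ^ (2 * s) - C'
        + D.cast * b.cast ^ 2
        - (p : ZMod (p ^ (k + s))) ^ (2 * (k - s)) * 3⁻¹ * 2⁻¹ * D.cast ^ 2 *
          b.cast ^ 2).cast : ZMod (p ^ k)) = 0 := by
      have h1 : (((D.cast : ZMod (p ^ (k + s)))).cast : ZMod (p ^ k)) = D.cast :=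
        CatMap.cast_trans (by omega) D
      have h2 : (((b.cast : ZMod (p ^ (k + s)))).cast : ZMod (p ^ k)) = b.cast :=
        CatMap.cast_trans (by omega) b
      have h3 : (p : ZMod (p ^ k)) ^ (2 * (k - s)) = 0 := CatMap.prime_pow_eq_zero (by omega)
      have hle : p ^ k ∣ p ^ (k + s) := pow_dvd_pow p (by omega)
      rw [← ZMod.castHom_apply (h := hle)] at h1 h2 hC' ⊢
      simp only [map_add, map_sub, map_mul, map_pow, map_neg, map_natCast, map_intCast, h1, h2, h3,
        hC']
      linear_combination -hsq
    obtain ⟨Θ, hΘ, huniq⟩ := CatMap.existsUnique_cast_mul_pow hw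
    refine ⟨Θ, ⟨C', hC', ⟨g, hg, rfl, hc⟩, hΘ⟩, ?_⟩
    rintro Θ' ⟨C'', -, ⟨B, -, hB, hBψ⟩, hΘ'⟩
    have hBg : B = g := Subtype.ext hB
    rw [hBg, hc] at hBψ
    -- `ψ ≠ 0` and the injectivity of the character make `C'`, and with it `Θ`, unique.
    have hCC : C'' = C' := by
      have h1 := ZMod.injective_stdAddChar (smul_left_injective ℂ hψ0 hBψ)
      have h2 := CatMap.two_unit (p := p) hp2 (k + s)
      linear_combination (C' - C'') * h2 - 2 * h1
    rw [hCC] at hΘ'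
    exact huniq Θ' hΘ'
  · rintro Θ ⟨C'', -, ⟨B, -, hB, hBψ⟩, hΘ⟩
    have hbu := CatMap.isUnit_cast_of_sq_eq (s := s) (by omega) hC hsq
    have hDu : IsUnit (D.cast : ZMod (p ^ s)) :=
      CatMap.isUnit_cast hsk (CatMap.isUnit_of_not_dvd_val hD)
    have hxu : IsUnit (x₀ : ZMod (p ^ s)) := CatMap.isUnit_intCast hx₀
    have hcast : ∀ {n : ℕ} (_ : n ≤ 2 * k) (a : ℤ),
        (((a : ZMod (p ^ (2 * k)))).cast : ZMod (p ^ n)) = a := fun hn a =>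
      ZMod.cast_intCast (pow_dvd_pow p hn) a
    -- the expansion of `ψ b` over the solutions
    have hcond : ∀ a : ZMod (p ^ k),
        (((![(a.cast : ZMod (p ^ (2 * k))), b] 0) ^ 2 -
          D * (![(a.cast : ZMod (p ^ (2 * k))), b] 1) ^ 2).cast : ZMod (p ^ k)) = -C ↔
        a ^ 2 = -C + D.cast * b.cast ^ 2 := by
      intro a
      have h1 := CatMap.cast_cast_of_le (p := p) hk2 a
      rw [← ZMod.castHom_apply (h := pow_dvd_pow p hk2)] at h1 ⊢
      simp only [Matrix.cons_val_zero, Matrix.cons_val_one, map_sub, map_mul, map_pow, h1,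
        ZMod.castHom_apply]
      exact sub_eq_iff_eq_add
    have hsum := CatMap.sum_solutions hp2 hs hx₀ (w := D.cast * b.cast)
      (by
        rw [CatMap.cast_mul_of_le (by omega), CatMap.cast_trans (by omega),
          CatMap.cast_trans (by omega)]
        exact hDu.mul hbu)
      (F := fun a => CatMap.coeff ![(a.cast : ZMod (p ^ (2 * k))), b] ψ)
      (fun a ha => (hsol a).1 ((hcond a).1 (by
        by_contra h
        exact ha (CatMap.coeff_eq_zero_of_mem_V hV h))))
    rw [← CatMap.apply_eq_sum_coeff ψ b] at hsum
    set A := 1 / Real.sqrt (1 - (legendreSym p (D.val : ℤ) : ℝ) * (1 / (p : ℝ))) with hA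
    have hA0 : 0 ≤ A := by positivity
    have hside : ∀ σ : ℤ, σ ^ 2 = 1 → ∃ α : ℂ, ‖α‖ = 1 ∧
        ∑ z ∈ Finset.Icc 1 (p ^ s), CatMap.coeff ![((((σ * x₀ : ℤ) : ZMod (p ^ k)) *
          (p : ZMod (p ^ k)) ^ s + (p : ZMod (p ^ k)) ^ (k - s) *
            ((z : ZMod (p ^ k)) * (D.cast * b.cast))).cast : ZMod (p ^ (2 * k))), b] ψ =
        A * (α * CatMap.expSum p s (CatMap.cubic p k s D b x₀ Θ σ)) := by
      intro σ hσ
      have hσ' : ∀ n : ℕ, (σ : ZMod (p ^ n)) ^ 2 = 1 := fun n => by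
        rw [← Int.cast_pow, hσ, Int.cast_one]
      have hσu : IsUnit (σ : ZMod (p ^ s)) :=
        IsUnit.of_mul_eq_one _ (by rw [← sq]; exact hσ' s)
      apply CatMap.exists_unit_mul hA0
      -- The congruence for `Θ` involves only `x₀²`, so the same `Θ` serves both orbits.
      have h1 := CatMap.norm_sum_orbit hp2 hp3 hs hB hBψ (b := b) (Θ := Θ)
        (y := ((σ * x₀ : ℤ) : ZMod (p ^ (2 * k)))) (by
          rw [hΘ, hcast hks]
          push_cast
          linear_combination (x₀ : ZMod (p ^ (k + s))) ^ 2 *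
            (p : ZMod (p ^ (k + s))) ^ (2 * s) * hσ' (k + s))
        (by
          rw [hcast hsk]
          push_cast
          exact ((hσu.mul hxu).mul hDu).mul hbu)
      have h2 : ∀ z : ℕ, (((((σ * x₀ : ℤ) : ZMod (p ^ (2 * k))) *
          (p : ZMod (p ^ (2 * k))) ^ s + (p : ZMod (p ^ (2 * k))) ^ (k - s) *
          ((z : ZMod (p ^ (2 * k))) * (D * b))).cast : ZMod (p ^ k))) =
          ((σ * x₀ : ℤ) : ZMod (p ^ k)) * (p : ZMod (p ^ k)) ^ s +
            (p : ZMod (p ^ k)) ^ (k - s) * ((z : ZMod (p ^ k)) * (D.cast * b.cast)) := by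
        intro z
        rw [← ZMod.castHom_apply (h := pow_dvd_pow p hk2)]
        simp only [map_add, map_mul, map_pow, map_natCast, map_intCast, ZMod.castHom_apply]
      simp_rw [h2] at h1
      rw [h1]
      congr 1
      · rw [hA]
        apply CatMap.norm_coeff hp2 hk hC hD hψ hV
        rw [← ZMod.castHom_apply (h := pow_dvd_pow p hk2)]
        simp only [Matrix.cons_val_zero, Matrix.cons_val_one, map_sub, map_mul, map_pow,
          map_natCast, map_intCast]
        push_cast
        rw [ZMod.castHom_apply, ZMod.castHom_apply]
        linear_combination ((x₀ : ZMod (p ^ k)) * (p : ZMod (p ^ k)) ^ s) ^ 2 * hσ' k + hsq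
      -- The orbit sum and the sum over `cubic` are compared only in modulus: both equal `√(p^s)`.
      · symm
        refine CatMap.norm_cubic_sum_Icc hp2 (show k - 2 * s ≠ 0 by omega) Θ
          (((hσu.mul hxu).mul hDu).mul hbu)
          (3⁻¹ * (D.cast : ZMod (p ^ s)) ^ 2 * (b.cast : ZMod (p ^ s)) ^ 2) fun z => ?_
        rw [CatMap.cubic]
        ring
    obtain ⟨α, hα, hα'⟩ := hside 1 (by norm_num)
    obtain ⟨β, hβ, hβ'⟩ := hside (-1) (by norm_num)
    refine ⟨α, β, hα, hβ, ?_⟩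
    rw [mul_add, ← hα', ← hβ', hsum]
    push_cast
    simp only [one_mul, neg_mul]
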